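/- Let $(\mathcal X,\pi_{\mathrm{ref}})$ be a probability space and let $r:\mathcal X\to\mathbb R$ be a measurable reward whose law under $\pi_{\mathrm{ref}}$ is the uniform distribution on $[0,1]$. For $\mu>0$, let $q_\mu$ be the law of the output of Best-of-Poisson: draw $n'\sim\mathrm{Poisson}(\mu)$, independently draw $n'+1$ i.i.d. samples from $\pi_{\mathrm{ref}}$, and return a sample with the largest reward among them. For $\lambda>0$, let $g_\lambda$ be the exponential tilt $$\frac{dg_\lambda}{d\pi_{\mathrm{ref}}}(x)=\frac{e^{\lambda r(x)}}{Z(\lambda)},\qquad Z(\lambda)=\int e^{\lambda r}\,d\pi_{\mathrm{ref}}.$$ Then: 1. For all $\mu,\lambda>0$, $\pi_{\mathrm{ref}}$-almost everywhere, $$\frac{dq_\mu}{d\pi_{\mathrm{ref}}}=(1+\mu r)\,e^{\mu(r-1)}\qquad\text{and}\qquad \frac{dg_\lambda}{d\pi_{\mathrm{ref}}}=\frac{\lambda e^{\lambda r}}{e^\lambda-1}.$$ 2. For every reward level $m\in(1/2,1)$ there are $\mu>0$ and $\lambda>0$ with $\mathbb E_{q_\mu}[r]=m=\mathbb E_{g_\lambda}[r]$.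 3. For every $\mu>0$ there is a unique $\lambda>0$ with $\mathbb E_{q_\mu}[r]=\mathbb E_{g_\lambda}[r]$. 4. For every $\mu>0$ and $\lambda>0$ with $\mathbb E_{q_\mu}[r]=\mathbb E_{g_\lambda}[r]$, the Kullback–Leibler divergences below are finite and $$0\le D_{\mathrm{KL}}(q_\mu\|\pi_{\mathrm{ref}})-D_{\mathrm{KL}}(g_\lambda\|\pi_{\mathrm{ref}})=D_{\mathrm{KL}}(q_\mu\|g_\lambda)\le 8\times10^{-4}.$$ -/

import Mathlib

open MeasureTheory ProbabilityTheory InformationTheory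
open scoped ENNReal NNReal

namespace BestOfPoisson

variable {X : Type*}

/-- `bestOf r n x` is an entry of largest reward `r` among the `n + 1` samples `x 0, …, x n`
(the earliest one if several entries attain the largest reward). -/
noncomputable def bestOf (r : X → ℝ) : ℕ → (ℕ → X) → X
  | 0, x => x 0
  | n + 1, x => if r (bestOf r n x) < r (x (n + 1)) then x (n + 1) else bestOf r n x

theorem exists_bestOf_eq (r : X → ℝ) (n : ℕ) (x : ℕ → X) : ∃ i ≤ n, bestOf r n x = x i := by
  induction n with
  | zero => exact ⟨0, le_rfl, rfl⟩
  | succ n ih =>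
    obtain ⟨i, hi, h⟩ := ih
    by_cases hlt : r (bestOf r n x) < r (x (n + 1))
    · exact ⟨n + 1, le_rfl, by simp [bestOf, hlt]⟩
    · exact ⟨i, by omega, by rw [← h]; simp [bestOf, hlt]⟩

theorem le_bestOf (r : X → ℝ) (n : ℕ) (x : ℕ → X) : ∀ i ≤ n, r (x i) ≤ r (bestOf r n x) := by
  induction n with
  | zero =>
    intro i hi
    obtain rfl : i = 0 := by omega
    exact le_rfl
  | succ n ih =>
    intro i hi
    by_cases hlt : r (bestOf r n x) < r (x (n + 1))
    · have e : bestOf r (n + 1) x = x (n + 1) := by simp [bestOf, hlt]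
      rw [e]
      rcases Nat.lt_or_ge n i with h | h
      · obtain rfl : i = n + 1 := by omega
        exact le_rfl
      · exact (ih i h).trans hlt.le
    · have e : bestOf r (n + 1) x = bestOf r n x := by simp [bestOf, hlt]
      rw [e]
      rcases Nat.lt_or_ge n i with h | h
      · obtain rfl : i = n + 1 := by omega
        exact not_lt.mp hlt
      · exact ih i h

variable [MeasurableSpace X]

theorem measurable_bestOf {r : X → ℝ} (hr : Measurable r) (n : ℕ) : Measurable (bestOf r n) := by
  induction n with
  | zero => exact measurable_pi_apply 0
  | succ n ih =>
    exact Measurable.ite (measurableSet_lt (hr.comp ih) (hr.comp (measurable_pi_apply (n + 1))))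
      (measurable_pi_apply (n + 1)) ih

theorem measurable_bestOf_uncurry {r : X → ℝ} (hr : Measurable r) :
    Measurable fun p : ℕ × (ℕ → X) => bestOf r p.1 p.2 :=
  measurable_from_prod_countable_right fun n => measurable_bestOf hr n

/-- The law of the Best-of-Poisson output: draw `n'` from the Poisson distribution with rate `μ`
and, independently, i.i.d. samples `x 0, x 1, …` from `ref`; return the one with the largest
reward among the first `n' + 1` samples. -/
noncomputable def bopLaw (ref : Measure X) (r : X → ℝ) (μ : ℝ≥0) : Measure X :=
  ((poissonMeasure μ).prod (Measure.infinitePi fun _ : ℕ => ref)).map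
    fun p : ℕ × (ℕ → X) => bestOf r p.1 p.2

theorem isProbabilityMeasure_bopLaw (ref : Measure X) [IsProbabilityMeasure ref] {r : X → ℝ}
    (hr : Measurable r) (μ : ℝ≥0) : IsProbabilityMeasure (bopLaw ref r μ) :=
  Measure.isProbabilityMeasure_map (measurable_bestOf_uncurry hr).aemeasurable

/-- The exponential tilt of `ref` by the reward,
`dg_l = exp (l * r) / Z l dref` with `Z l = ∫ exp (l * r) dref`. -/
noncomputable def tiltLaw (ref : Measure X) (r : X → ℝ) (l : ℝ) : Measure X :=
  ref.tilted fun x => l * r x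

/-- The expected reward `E_{x ∼ p} [r x]`. -/
noncomputable def meanReward (p : Measure X) (r : X → ℝ) : ℝ :=
  ∫ x, r x ∂p

/-- The Best-of-Poisson density on `[0, 1]`. -/
noncomputable def bopDensity (μ x : ℝ) : ℝ :=
  (1 + μ * x) * Real.exp (μ * (x - 1))

/-- The exponential-tilt density on `[0, 1]`. -/
noncomputable def tiltDensity (l x : ℝ) : ℝ :=
  l * Real.exp (l * x) / (Real.exp l - 1)

end BestOfPoisson

namespace BestOfPoisson

/-! With `n + 1` samples the best one has density `(n + 1) * r ^ n` (`map_bestOf`). Summing over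
Poisson weights gives the density `(1 + μ r) * exp (μ (r - 1))` (`bopLaw_eq_withDensity`). Every law
involved thus has a continuous positive density in the uniform variable `r`, and all means and
divergences become integrals over `[0, 1]` (`klDiv_withDensity_reward`).

The logarithm of a tilt density is affine in `r`, so its integral against a density depends only on
the mean of that density (`integral_mul_log_tiltDensity`). Equal means therefore give the
Pythagorean identity `KL(q‖ref) - KL(g‖ref) = KL(q‖g)`. They also give `KL(q‖g') - KL(q‖g) =
KL(g‖g') ≥ 0` for every other tilt `g'`. The matching tilt is thus the closest one, and it suffices
to exhibit, for each `μ`, some tilt within `8 * 10 ^ (-4)` of `q` (`exists_klUnit_le`); the matching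
parameter need not be known.

The parameter is `2 μ` for `μ ≤ 3 / 8`, where KL is bounded by the chi-square divergence. It is `μ +
1` for `μ ≥ 7`, where an asymptotic bound on the exponential integral suffices. In between it is `μ
+ s` with a piecewise constant rational `s`: the substitution `w = μ / (μ + 4)` and polynomial
bounds for the transcendental terms turn the claim into polynomial inequalities in `w`, checked by
exact rational arithmetic.

Existence of matching parameters is the intermediate value theorem. Uniqueness is strict
monotonicity of the tilt mean, which amounts to `x < sinh x`. -/

/-! ### Polynomials with rational coefficients, given by their coefficient lists -/

/-- The value at `x` of the polynomial with coefficient list `p` (constant term first). -/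
noncomputable def polyEval : List ℚ → ℝ → ℝ
  | [], _ => 0
  | c :: p, x => c + x * polyEval p x

/-- Sum of polynomials. -/
def polyAdd : List ℚ → List ℚ → List ℚ
  | [], q => q
  | p, [] => p
  | a :: p, b :: q => (a + b) :: polyAdd p q

/-- Scalar multiple of a polynomial. -/
def polySmul (a : ℚ) : List ℚ → List ℚ
  | [] => []
  | c :: p => (a * c) :: polySmul a p

/-- Product of polynomials. -/
def polyMul : List ℚ → List ℚ → List ℚ
  | [], _ => []
  | c :: p, q => polyAdd (polySmul c q) (0 :: polyMul p q)

/-- Derivative of a polynomial. -/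
def polyDeriv : List ℚ → List ℚ
  | [] => []
  | _ :: p => polyAdd p (0 :: polyDeriv p)

/-- The polynomial `x ↦ p (a + x)`. -/
def polyShift (a : ℚ) : List ℚ → List ℚ
  | [] => []
  | c :: p => polyAdd [c] (polyMul [a, 1] (polyShift a p))

/-- A lower bound of a polynomial on `[0, h]`. -/
def polyLower (h : ℚ) : List ℚ → ℚ
  | [] => 0
  | c :: p => c + min 0 (h * polyLower h p)

/-- A test for nonnegativity of a polynomial on `[0, n * h]`, in `n` cells of width `h`. -/
def polyCheck (h : ℚ) : ℕ → List ℚ → Bool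
  | 0, _ => true
  | n + 1, p => decide (0 ≤ polyLower h p) && polyCheck h n (polyShift h p)

@[simp] theorem polyEval_nil (x : ℝ) : polyEval [] x = 0 := rfl

@[simp] theorem polyEval_cons (c : ℚ) (p : List ℚ) (x : ℝ) :
    polyEval (c :: p) x = c + x * polyEval p x := rfl

@[simp] theorem polyEval_add (p q : List ℚ) (x : ℝ) :
    polyEval (polyAdd p q) x = polyEval p x + polyEval q x := by
  induction p generalizing q with
  | nil => simp [polyAdd]
  | cons a p ih =>
    cases q with
    | nil => simp [polyAdd]
    | cons b q =>
      simp only [polyAdd, polyEval_cons, ih]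
      push_cast
      ring

@[simp] theorem polyEval_smul (a : ℚ) (p : List ℚ) (x : ℝ) :
    polyEval (polySmul a p) x = a * polyEval p x := by
  induction p with
  | nil => simp [polySmul]
  | cons c p ih => simp [polySmul, ih]; ring

@[simp] theorem polyEval_mul (p q : List ℚ) (x : ℝ) :
    polyEval (polyMul p q) x = polyEval p x * polyEval q x := by
  induction p with
  | nil => simp [polyMul]
  | cons c p ih => simp [polyMul, ih, add_mul, mul_assoc]

theorem polyEval_shift (a : ℚ) (p : List ℚ) (x : ℝ) :
    polyEval (polyShift a p) x = polyEval p (a + x) := by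
  induction p with
  | nil => simp [polyShift]
  | cons c p ih => simp [polyShift, ih]

theorem hasDerivAt_polyEval (p : List ℚ) (x : ℝ) :
    HasDerivAt (polyEval p) (polyEval (polyDeriv p) x) x := by
  induction p with
  | nil => exact hasDerivAt_const x 0
  | cons c p ih =>
    have h := ((hasDerivAt_id x).mul ih).const_add (c : ℝ)
    have e : polyEval (polyDeriv (c :: p)) x =
        1 * polyEval p x + id x * polyEval (polyDeriv p) x := by simp [polyDeriv]
    rw [e]
    exact h

/-- Horner's scheme in interval form: a negative tail is at its worst when multiplied by `h`, a
nonnegative one contributes at least `0`. -/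
theorem polyLower_le (h : ℚ) (p : List ℚ) {x : ℝ} (h0 : 0 ≤ x) (hx : x ≤ h) :
    (polyLower h p : ℝ) ≤ polyEval p x := by
  induction p with
  | nil => simp [polyLower]
  | cons c p ih =>
    have key : min 0 ((h : ℝ) * polyLower h p) ≤ x * polyEval p x := by
      rcases le_or_gt 0 (polyEval p x) with hp | hp
      · exact (min_le_left _ _).trans (mul_nonneg h0 hp)
      · refine (min_le_right _ _).trans ?_
        have h1 : (h : ℝ) * polyLower h p ≤ h * polyEval p x :=
          mul_le_mul_of_nonneg_left ih (h0.trans hx)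
        have h2 : (h : ℝ) * polyEval p x ≤ x * polyEval p x :=
          mul_le_mul_of_nonpos_right hx hp.le
        exact h1.trans h2
    simp only [polyLower, polyEval_cons]
    push_cast
    linarith

theorem polyCheck_sound {h : ℚ} (n : ℕ) (p : List ℚ) (hc : polyCheck h n p = true)
    {x : ℝ} (h0 : 0 ≤ x) (hx : x ≤ n * h) (hn : n ≠ 0) : 0 ≤ polyEval p x := by
  induction n generalizing p x with
  | zero => exact absurd rfl hn
  | succ n ih =>
    simp only [polyCheck, Bool.and_eq_true, decide_eq_true_eq] at hc
    by_cases hxh : x ≤ h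
    · exact le_trans (by exact_mod_cast hc.1) (polyLower_le h p h0 hxh)
    · have hxh' : (h : ℝ) < x := not_le.mp hxh
      have hn' : n ≠ 0 := by
        rintro rfl
        norm_num at hx
        linarith
      have := ih _ hc.2 (x := x - h) (by linarith) (by push_cast at hx; linarith) hn'
      rwa [polyEval_shift, add_sub_cancel] at this

/-- Nonnegativity of a polynomial on `[a, b]`, by the test on `n` cells. -/
theorem polyEval_nonneg {a b : ℚ} {n : ℕ} (hn : n ≠ 0) {p : List ℚ}
    (hc : polyCheck ((b - a) / n) n (polyShift a p) = true) {x : ℝ} (ha : a ≤ x) (hb : x ≤ b) :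
    0 ≤ polyEval p x := by
  have hnr : (n : ℝ) ≠ 0 := by exact_mod_cast hn
  have := polyCheck_sound n _ hc (x := x - a) (by linarith)
    (by push_cast; rw [mul_div_cancel₀ _ hnr]; linarith) hn
  rwa [polyEval_shift, add_sub_cancel] at this

/-! ### Polynomial certificates in `w = t / (t + 4)` for `3 / 8 ≤ t ≤ 7` -/

/-- The polynomial `1 - w`. -/
def polyV : List ℚ := [1, -1]

/-- An upper bound of `exp (-t) * ∫ x in 0..t, exp x / (1 + x)` on `[0, 7]`, as a polynomial in
`t / (t + 4)`. -/
def polyR : List ℚ := polySmul (1 / 10 ^ 5) [2, 399997, -1199642, 1455680, -2112048, 4687868,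
  -7376438, 8545156, -7039173, 2689643]

/-- An approximation of `exp (-t)` on `[0, 7]`, as a polynomial in `t / (t + 4)`. -/
def polyE : List ℚ := polySmul (1 / 10 ^ 5) [100000, -400002, 400194, 127839, -67021, -605416,
  1402047, -3057691, 3481587, -1385900]

/-- An upper bound of `exp (-t)` on `[0, 7]`. -/
def polyEhi : List ℚ := polyAdd polyE [1 / 10 ^ 5]

/-- A lower bound of `exp (-t)` on `[0, 7]`. -/
def polyElo : List ℚ := polyAdd polyE [-1 / 10 ^ 5]

/-- If `f t = p (t / (t + 4))`, then `f t + f' t = polyOde p (t / (t + 4))`. -/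
def polyOde (p : List ℚ) : List ℚ :=
  polyAdd p (polySmul (1 / 4) (polyMul (polyMul polyV polyV) (polyDeriv p)))

/-- Since `1 + t = (1 + 3 * w) / (1 - w)`, this is the supersolution inequality `1 / (1 + t) ≤ y +
y'` with denominators cleared. The endpoint `7 / 11` corresponds to `t = 7`. -/
theorem polyR_ode {w : ℝ} (h0 : 0 ≤ w) (h1 : w ≤ 7 / 11) :
    0 ≤ (1 + 3 * w) * polyEval (polyOde polyR) w - (1 - w) := by
  have := polyEval_nonneg (a := 0) (b := 7 / 11) (n := 24) (by norm_num)
    (p := polyAdd (polyMul [1, 3] (polyOde polyR)) [-1, 1]) (by decide +kernel) (x := w)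
    (by simpa using h0) (by push_cast; exact h1)
  simp only [polyEval_add, polyEval_mul, polyEval_cons, polyEval_nil] at this
  push_cast at this
  linarith

/-- The exact solution `exp (-t)` has `y + y' = 0`. Shifting `polyE` by `1 / 10 ^ 5` shifts `y + y'`
by the same amount, which covers the residual of the approximation; `polyElo` uses the opposite
shift. -/
theorem polyEhi_ode {w : ℝ} (h0 : 0 ≤ w) (h1 : w ≤ 7 / 11) :
    0 ≤ polyEval (polyOde polyEhi) w :=
  polyEval_nonneg (a := 0) (b := 7 / 11) (n := 24) (by norm_num)
    (by decide +kernel) (by simpa using h0) (by push_cast; exact h1)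

set_option maxHeartbeats 1000000 in
theorem polyElo_ode {w : ℝ} (h0 : 0 ≤ w) (h1 : w ≤ 7 / 11) :
    polyEval (polyOde polyElo) w ≤ 0 := by
  have := polyEval_nonneg (a := 0) (b := 7 / 11) (n := 48) (by norm_num)
    (p := polySmul (-1) (polyOde polyElo)) (by decide +kernel) (x := w)
    (by simpa using h0) (by push_cast; exact h1)
  rw [polyEval_smul] at this
  push_cast at this
  linarith

/-- The polynomial `4 * w + s * (1 - w)`. -/
def polyL (s : ℚ) : List ℚ := [s, 4 - s]

/-- The polynomial `(1 + 3 * w) * (1 - k * E w) - L w`. -/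
def polyN (s k : ℚ) : List ℚ :=
  polyAdd (polyMul [1, 3] (polyAdd [1] (polySmul (-k) polyElo))) (polySmul (-1) (polyL s))

/-- The gap `8 * 10 ^ (-4) - KL`, with cleared denominators, as a polynomial in `t / (t + 4)`. -/
def polyGap (s k : ℚ) : List ℚ :=
  polyAdd (polySmul (128 / 10 ^ 4) (polyMul [0, 0, 1] (polyMul (polyL s) (polyL s))))
    (polyAdd (polySmul (-4) (polyMul [0, 1] (polyMul polyV (polyMul (polyMul (polyL s) (polyL s))
        (polyAdd polyR (polyAdd polyEhi [s - 1]))))))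
      (polyAdd (polySmul s (polyMul (polyMul polyV polyV) (polyMul (polyMul (polyL s) (polyL s))
          (polyAdd [1] (polySmul (-1) polyEhi)))))
        (polySmul (-16) (polyMul [0, 0, 1] (polyAdd (polyMul (polyN s k) (polyL s))
          (polySmul (-1 / 2) (polyMul (polyN s k) (polyN s k))))))))

/-- Signs of `polyGap s k` and `polyN s k` on a cell `[a, b]`, by the test on `n` and `2` cells. -/
theorem polyGap_nonneg {s k a b : ℚ} (n : ℕ) (hn : n ≠ 0)
    (h1 : polyCheck ((b - a) / n) n (polyShift a (polyGap s k)) = true)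
    (h2 : polyCheck ((b - a) / (2 : ℕ)) 2 (polyShift a (polySmul (-1) (polyN s k))) = true)
    {w : ℝ} (ha : a ≤ w) (hb : w ≤ b) : 0 ≤ polyEval (polyGap s k) w ∧ polyEval (polyN s k) w ≤ 0 := by
  refine ⟨polyEval_nonneg hn h1 ha hb, ?_⟩
  have := polyEval_nonneg two_ne_zero h2 ha hb
  rw [polyEval_smul] at this
  push_cast at this
  linarith

theorem le_exp_neg {x : ℝ} (h0 : 0 ≤ x) (h1 : x ≤ 1) :
    1 - x + x ^ 2 / 2 - x ^ 3 / 6 + x ^ 4 / 24 - x ^ 5 / 120 ≤ Real.exp (-x) := by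
  -- With `n = 7` the Taylor sum includes `x ^ 6 / 720`, which absorbs the remainder of order `x ^
  -- 7` and is then dropped.
  have h := (abs_le.1 (Real.exp_bound (x := -x) (by rw [abs_neg, abs_of_nonneg h0]; exact h1)
    (n := 7) (by norm_num))).1
  rw [abs_neg, abs_of_nonneg h0] at h
  simp only [Finset.sum_range_succ, Finset.sum_range_zero, Nat.factorial] at h
  norm_num at h
  have h6 : x ^ 7 ≤ x ^ 6 := pow_le_pow_of_le_one h0 h1 (by norm_num)
  have h7 : 0 ≤ x ^ 6 := by positivity
  nlinarith

/-- The Taylor bound needs an argument in `[0, 1]`, so it is applied at `s / 4` and raised to the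
fourth power. -/
theorem le_exp_neg_of_le_pow {s k : ℚ} (h0 : 0 ≤ s) (h1 : s ≤ 4)
    (hk : k ≤ (1 - (s / 4) + (s / 4) ^ 2 / 2 - (s / 4) ^ 3 / 6 + (s / 4) ^ 4 / 24
      - (s / 4) ^ 5 / 120) ^ 4)
    (hp : 0 ≤ 1 - (s / 4) + (s / 4) ^ 2 / 2 - (s / 4) ^ 3 / 6 + (s / 4) ^ 4 / 24
      - (s / 4) ^ 5 / 120) : (k : ℝ) ≤ Real.exp (-s) := by
  have h0' : (0 : ℝ) ≤ s := by exact_mod_cast h0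
  have h1' : (s : ℝ) ≤ 4 := by exact_mod_cast h1
  have h := le_exp_neg (x := (s : ℝ) / 4) (by linarith) (by linarith)
  have e : Real.exp (-(s : ℝ)) = Real.exp (-((s : ℝ) / 4)) ^ 4 := by
    rw [← Real.exp_nat_mul]
    congr 1
    push_cast
    ring
  rw [e]
  refine le_trans ?_ (pow_le_pow_left₀ ?_ h 4)
  · exact_mod_cast hk
  · exact_mod_cast hp

set_option maxHeartbeats 1000000 in
/-- For each `w` in `[3 / 35, 7 / 11]` some offset `s` makes the gap polynomial nonnegative. -/
theorem exists_polyGap_nonneg {w : ℝ} (h0 : 3 / 35 ≤ w) (h1 : w ≤ 7 / 11) :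
    ∃ s k : ℚ, 0 < s ∧ 0 ≤ k ∧ (k : ℝ) ≤ Real.exp (-s) ∧
      0 ≤ polyEval (polyGap s k) w ∧ polyEval (polyN s k) w ≤ 0 := by
  -- The cell ends are the values of `t / (t + 4)` at `t = 3/8, 1/2, 7/10, 1, 3/2, 11/5, 7`. Each
  -- `s` is the offset of the tilt parameter from `t`, and `k` is `exp (-s)` rounded down to four
  -- decimals.
  rcases le_total w (1 / 9) with hh0 | hh0
  · exact ⟨2 / 5, 6703 / 10000, by norm_num, by norm_num,
      le_exp_neg_of_le_pow (by norm_num) (by norm_num) (by norm_num) (by norm_num),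
      polyGap_nonneg (a := 3 / 35) (b := 1 / 9) 1 (by norm_num) (by decide +kernel)
        (by decide +kernel) (by push_cast; exact h0) (by push_cast; exact hh0)⟩
  rcases le_total w (7 / 47) with hh1 | hh1
  · exact ⟨1 / 2, 6065 / 10000, by norm_num, by norm_num,
      le_exp_neg_of_le_pow (by norm_num) (by norm_num) (by norm_num) (by norm_num),
      polyGap_nonneg (a := 1 / 9) (b := 7 / 47) 1 (by norm_num) (by decide +kernel)
        (by decide +kernel) (by push_cast; exact hh0) (by push_cast; exact hh1)⟩
  rcases le_total w (1 / 5) with hh2 | hh2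
  · exact ⟨3 / 5, 5488 / 10000, by norm_num, by norm_num,
      le_exp_neg_of_le_pow (by norm_num) (by norm_num) (by norm_num) (by norm_num),
      polyGap_nonneg (a := 7 / 47) (b := 1 / 5) 1 (by norm_num) (by decide +kernel)
        (by decide +kernel) (by push_cast; exact hh1) (by push_cast; exact hh2)⟩
  rcases le_total w (3 / 11) with hh3 | hh3
  · exact ⟨3 / 4, 4723 / 10000, by norm_num, by norm_num,
      le_exp_neg_of_le_pow (by norm_num) (by norm_num) (by norm_num) (by norm_num),
      polyGap_nonneg (a := 1 / 5) (b := 3 / 11) 1 (by norm_num) (by decide +kernel)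
        (by decide +kernel) (by push_cast; exact hh2) (by push_cast; exact hh3)⟩
  rcases le_total w (11 / 31) with hh4 | hh4
  · exact ⟨9 / 10, 4065 / 10000, by norm_num, by norm_num,
      le_exp_neg_of_le_pow (by norm_num) (by norm_num) (by norm_num) (by norm_num),
      polyGap_nonneg (a := 3 / 11) (b := 11 / 31) 1 (by norm_num) (by decide +kernel)
        (by decide +kernel) (by push_cast; exact hh3) (by push_cast; exact hh4)⟩
  · exact ⟨21 / 20, 3499 / 10000, by norm_num, by norm_num,
      le_exp_neg_of_le_pow (by norm_num) (by norm_num) (by norm_num) (by norm_num),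
      polyGap_nonneg (a := 11 / 31) (b := 7 / 11) 16 (by norm_num) (by decide +kernel)
        (by decide +kernel) (by push_cast; exact hh4) (by push_cast; exact h1)⟩

/-! ### The shifted exponential integral -/

/-- The integral `∫ x in 0..t, exp x / (1 + x)`, for `0 ≤ t`. -/
noncomputable def expIntegral (t : ℝ) : ℝ := ∫ x in (0 : ℝ)..t, Real.exp x / (1 + |x|)

theorem hasDerivAt_expIntegral {t : ℝ} (ht : 0 ≤ t) :
    HasDerivAt expIntegral (Real.exp t / (1 + t)) t := by
  -- The absolute value in `expIntegral` keeps the integrand continuous on the whole line, so the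
  -- derivative is two-sided even at `t = 0`.
  have hc : Continuous fun x : ℝ => Real.exp x / (1 + |x|) :=
    Real.continuous_exp.div (by fun_prop) fun x => by positivity
  have h := (hc.integral_hasStrictDerivAt 0 t).hasDerivAt
  rw [abs_of_nonneg ht] at h
  exact h

theorem expIntegral_zero : expIntegral 0 = 0 := by simp [expIntegral]

/-- A supersolution of `y + y' = 1 / (1 + t)` stays above the solution. -/
theorem exp_neg_mul_expIntegral_le {R R' : ℝ → ℝ} {a b : ℝ} (ha : 0 ≤ a)
    (hR : ∀ t ∈ Set.Icc a b, HasDerivAt R (R' t) t)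
    (hode : ∀ t ∈ Set.Icc a b, 1 / (1 + t) ≤ R t + R' t)
    (h0 : Real.exp (-a) * expIntegral a ≤ R a) {t : ℝ} (ht : t ∈ Set.Icc a b) :
    Real.exp (-t) * expIntegral t ≤ R t := by
  -- Integrating factor: `exp x * R x - expIntegral x` has derivative `exp x * (R x + R' x - 1 / (1
  -- + x))`, which is nonnegative.
  have hd : ∀ x ∈ Set.Icc a b, HasDerivAt (fun x => Real.exp x * R x - expIntegral x)
      (Real.exp x * R x + Real.exp x * R' x - Real.exp x / (1 + x)) x := fun x hx =>
    ((Real.hasDerivAt_exp x).mul (hR x hx)).sub (hasDerivAt_expIntegral (ha.trans hx.1))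
  have hm : MonotoneOn (fun x => Real.exp x * R x - expIntegral x) (Set.Icc a b) := by
    refine monotoneOn_of_hasDerivWithinAt_nonneg (convex_Icc a b)
      (fun x hx => (hd x hx).continuousAt.continuousWithinAt)
      (fun x hx => (hd x (interior_subset hx)).hasDerivWithinAt) fun x hx => ?_
    have h1 := mul_le_mul_of_nonneg_left (hode x (interior_subset hx)) (Real.exp_pos x).le
    rw [mul_add, mul_one_div] at h1
    linarith
  have hab : a ≤ b := ht.1.trans ht.2
  have h := hm (Set.left_mem_Icc.2 hab) ht ht.1
  have e : ∀ x : ℝ, Real.exp (-x) * Real.exp x = 1 := fun x => by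
    rw [← Real.exp_add, neg_add_cancel, Real.exp_zero]
  have e1 : 0 ≤ Real.exp a * R a - expIntegral a := by
    have := mul_le_mul_of_nonneg_left h0 (Real.exp_pos a).le
    rw [← mul_assoc, mul_comm (Real.exp a) (Real.exp (-a)), e, one_mul] at this
    linarith
  have e2 : expIntegral t ≤ Real.exp t * R t := by simp only at h; linarith
  have := mul_le_mul_of_nonneg_left e2 (Real.exp_pos (-t)).le
  rwa [← mul_assoc, e, one_mul] at this

theorem hasDerivAt_div_add_four {t : ℝ} (ht : 0 ≤ t) :
    HasDerivAt (fun t : ℝ => t / (t + 4)) ((1 - t / (t + 4)) ^ 2 / 4) t := by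
  have h := (hasDerivAt_id t).div ((hasDerivAt_id t).add_const 4) (by simp; positivity)
  refine HasDerivAt.congr_deriv h ?_
  simp only [id]
  field_simp
  ring

theorem hasDerivAt_polyEval_comp (p : List ℚ) {t : ℝ} (ht : 0 ≤ t) :
    HasDerivAt (fun t : ℝ => polyEval p (t / (t + 4)))
      (polyEval (polyOde p) (t / (t + 4)) - polyEval p (t / (t + 4))) t := by
  have h := (hasDerivAt_polyEval p (t / (t + 4))).comp t (hasDerivAt_div_add_four ht)
  refine HasDerivAt.congr_deriv h ?_
  simp only [polyOde, polyV, polyEval_add, polyEval_smul, polyEval_mul, polyEval_cons,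
    polyEval_nil]
  push_cast
  ring

theorem div_add_four_mem {t : ℝ} (h0 : 0 ≤ t) (h1 : t ≤ 7) :
    0 ≤ t / (t + 4) ∧ t / (t + 4) ≤ 7 / 11 := by
  refine ⟨by positivity, ?_⟩
  rw [div_le_div_iff₀ (by positivity) (by norm_num)]
  linarith

theorem exp_neg_mul_expIntegral_le_polyR {t : ℝ} (h0 : 0 ≤ t) (h1 : t ≤ 7) :
    Real.exp (-t) * expIntegral t ≤ polyEval polyR (t / (t + 4)) := by
  refine exp_neg_mul_expIntegral_le (R := fun t => polyEval polyR (t / (t + 4))) (a := 0) (b := 7)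
    le_rfl (fun x hx => hasDerivAt_polyEval_comp polyR hx.1) (fun x hx => ?_) ?_ ⟨h0, h1⟩
  · obtain ⟨w0, w1⟩ := div_add_four_mem hx.1 hx.2
    have h := polyR_ode w0 w1
    have hx0 := hx.1
    have e : 1 / (1 + x) = (1 - x / (x + 4)) / (1 + 3 * (x / (x + 4))) := by
      field_simp
      ring
    rw [e, div_le_iff₀ (by positivity)]
    linarith
  · simp [expIntegral_zero, polyR, polySmul]

theorem exp_neg_le_polyEhi {t : ℝ} (h0 : 0 ≤ t) (h1 : t ≤ 7) :
    Real.exp (-t) ≤ polyEval polyEhi (t / (t + 4)) := by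
  have hd : ∀ x ∈ Set.Icc (0 : ℝ) 7,
      HasDerivAt (fun x => Real.exp x * polyEval polyEhi (x / (x + 4)))
        (Real.exp x * polyEval (polyOde polyEhi) (x / (x + 4))) x := fun x hx => by
    refine HasDerivAt.congr_deriv
      ((Real.hasDerivAt_exp x).mul (hasDerivAt_polyEval_comp polyEhi hx.1)) ?_
    ring
  have hm : MonotoneOn (fun x => Real.exp x * polyEval polyEhi (x / (x + 4))) (Set.Icc 0 7) :=
    monotoneOn_of_hasDerivWithinAt_nonneg (convex_Icc 0 7)
      (fun x hx => (hd x hx).continuousAt.continuousWithinAt)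
      (fun x hx => (hd x (interior_subset hx)).hasDerivWithinAt) fun x hx =>
        have hx' := interior_subset hx
        have hw := div_add_four_mem hx'.1 hx'.2
        mul_nonneg (Real.exp_pos x).le (polyEhi_ode hw.1 hw.2)
  have h := hm (Set.left_mem_Icc.2 (by norm_num)) ⟨h0, h1⟩ h0
  have e0 : polyEval polyEhi (0 / (0 + 4)) = 1 + 1 / 10 ^ 5 := by
    simp only [polyEhi, polyE, polySmul, polyAdd, polyEval_cons]
    norm_num
  simp only [Real.exp_zero, one_mul, e0] at h
  rw [Real.exp_neg, inv_eq_one_div, div_le_iff₀' (Real.exp_pos t)]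
  linarith

theorem polyElo_le_exp_neg {t : ℝ} (h0 : 0 ≤ t) (h1 : t ≤ 7) :
    polyEval polyElo (t / (t + 4)) ≤ Real.exp (-t) := by
  have hd : ∀ x ∈ Set.Icc (0 : ℝ) 7,
      HasDerivAt (fun x => Real.exp x * polyEval polyElo (x / (x + 4)))
        (Real.exp x * polyEval (polyOde polyElo) (x / (x + 4))) x := fun x hx => by
    refine HasDerivAt.congr_deriv
      ((Real.hasDerivAt_exp x).mul (hasDerivAt_polyEval_comp polyElo hx.1)) ?_
    ring
  have hm : AntitoneOn (fun x => Real.exp x * polyEval polyElo (x / (x + 4))) (Set.Icc 0 7) :=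
    antitoneOn_of_hasDerivWithinAt_nonpos (convex_Icc 0 7)
      (fun x hx => (hd x hx).continuousAt.continuousWithinAt)
      (fun x hx => (hd x (interior_subset hx)).hasDerivWithinAt) fun x hx =>
        have hx' := interior_subset hx
        have hw := div_add_four_mem hx'.1 hx'.2
        mul_nonpos_of_nonneg_of_nonpos (Real.exp_pos x).le (polyElo_ode hw.1 hw.2)
  have h := hm (Set.left_mem_Icc.2 (by norm_num)) ⟨h0, h1⟩ h0
  have e0 : polyEval polyElo (0 / (0 + 4)) = 1 - 1 / 10 ^ 5 := by
    simp only [polyElo, polyE, polySmul, polyAdd, polyEval_cons]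
    norm_num
  simp only [Real.exp_zero, one_mul, e0] at h
  rw [Real.exp_neg, inv_eq_one_div, le_div_iff₀' (Real.exp_pos t)]
  linarith

/-- With `y = 1 / (1 + t)` the asymptotic series is `y + y ^ 2 + 2 * y ^ 3 + 6 * y ^ 4 + ⋯`.
Doubling the last coefficient to `12` leaves the excess `6 * y ^ 4 - 48 * y ^ 5` in `y + y'`-form,
nonnegative exactly when `y ≤ 1 / 8`, that is `t ≥ 7`. The initial value at `7` comes from `polyR`.
-/
theorem exp_neg_mul_expIntegral_le_tail {t : ℝ} (ht : 7 ≤ t) :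
    Real.exp (-t) * expIntegral t ≤
      1 / (1 + t) + (1 / (1 + t)) ^ 2 + 2 * (1 / (1 + t)) ^ 3 + 12 * (1 / (1 + t)) ^ 4 := by
  have hd : ∀ x : ℝ, 0 ≤ x → HasDerivAt (fun x : ℝ => 1 / (1 + x)) (-(1 / (1 + x)) ^ 2) x :=
    fun x hx => by
      have h := ((hasDerivAt_id x).const_add 1).inv (by simp; positivity)
      simp only [one_div]
      refine HasDerivAt.congr_deriv h ?_
      simp [neg_div]
  refine exp_neg_mul_expIntegral_le
    (R := fun t => 1 / (1 + t) + (1 / (1 + t)) ^ 2 + 2 * (1 / (1 + t)) ^ 3 + 12 * (1 / (1 + t)) ^ 4)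
    (R' := fun t => -(1 / (1 + t)) ^ 2 * (1 + 2 * (1 / (1 + t)) + 6 * (1 / (1 + t)) ^ 2
      + 48 * (1 / (1 + t)) ^ 3)) (a := 7) (b := t) (by norm_num) (fun x hx => ?_) (fun x hx => ?_) ?_
    ⟨ht, le_rfl⟩
  · have h := hd x (by linarith [hx.1])
    refine HasDerivAt.congr_deriv
      (((h.add (h.pow 2)).add ((h.pow 3).const_mul 2)).add ((h.pow 4).const_mul 12)) ?_
    push_cast
    ring
  · have hx7 : (7 : ℝ) ≤ x := hx.1
    have hy : 1 / (1 + x) ≤ 1 / 8 := one_div_le_one_div_of_le (by norm_num) (by linarith)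
    have hy0 : 0 ≤ 1 / (1 + x) := by positivity
    generalize 1 / (1 + x) = y at hy hy0
    have : 0 ≤ y ^ 4 * (6 - 48 * y) := mul_nonneg (by positivity) (by linarith)
    linarith
  · refine (exp_neg_mul_expIntegral_le_polyR (by norm_num) le_rfl).trans ?_
    simp only [polyR, polySmul, polyEval_cons, polyEval_nil]
    norm_num

/-! ### Integrals of the two densities over `[0, 1]` -/

theorem continuous_bopDensity (t : ℝ) : Continuous (bopDensity t) := by
  unfold bopDensity
  fun_prop

theorem continuous_tiltDensity (l : ℝ) : Continuous (tiltDensity l) := by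
  unfold tiltDensity
  fun_prop

theorem bopDensity_pos {t x : ℝ} (ht : 0 < t) (hx : 0 ≤ x) : 0 < bopDensity t x := by
  unfold bopDensity
  positivity

theorem exp_sub_one_pos {l : ℝ} (hl : 0 < l) : 0 < Real.exp l - 1 := by
  linarith [Real.add_one_lt_exp hl.ne']

theorem tiltDensity_pos {l : ℝ} (hl : 0 < l) (x : ℝ) : 0 < tiltDensity l x :=
  div_pos (mul_pos hl (Real.exp_pos _)) (exp_sub_one_pos hl)

theorem log_bopDensity {t x : ℝ} (ht : 0 < t) (hx : 0 ≤ x) :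
    Real.log (bopDensity t x) = Real.log (1 + t * x) + t * (x - 1) := by
  rw [bopDensity, Real.log_mul (by positivity) (Real.exp_pos _).ne', Real.log_exp]

theorem log_tiltDensity {l : ℝ} (hl : 0 < l) (x : ℝ) :
    Real.log (tiltDensity l x) = l * x + Real.log (l / (Real.exp l - 1)) := by
  have h := exp_sub_one_pos hl
  rw [tiltDensity, mul_div_right_comm, Real.log_mul (div_pos hl h).ne' (Real.exp_pos _).ne',
    Real.log_exp, add_comm]

theorem hasDerivAt_exp_mul_sub (t x : ℝ) :
    HasDerivAt (fun x => Real.exp (t * (x - 1))) (Real.exp (t * (x - 1)) * t) x := by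
  have h := (((hasDerivAt_id x).sub_const 1).const_mul t).exp
  simpa using h

theorem hasDerivAt_exp_mul (l x : ℝ) :
    HasDerivAt (fun x => Real.exp (l * x)) (Real.exp (l * x) * l) x := by
  have h := ((hasDerivAt_id x).const_mul l).exp
  simpa using h

theorem integral_eq_sub_of_continuousOn {f F : ℝ → ℝ}
    (hF : ∀ x ∈ Set.Icc (0 : ℝ) 1, HasDerivAt F (f x) x) (hf : ContinuousOn f (Set.Icc 0 1)) :
    ∫ x in (0 : ℝ)..1, f x = F 1 - F 0 := by
  refine intervalIntegral.integral_eq_sub_of_hasDerivAt (fun x hx => hF x ?_) ?_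
  · rwa [Set.uIcc_of_le zero_le_one] at hx
  · exact ContinuousOn.intervalIntegrable (by rwa [Set.uIcc_of_le zero_le_one])

theorem integral_bopDensity (t : ℝ) : ∫ x in (0 : ℝ)..1, bopDensity t x = 1 := by
  rw [integral_eq_sub_of_continuousOn (F := fun x => x * Real.exp (t * (x - 1))) (fun x _ => ?_)
    (continuous_bopDensity t).continuousOn]
  · simp
  · refine HasDerivAt.congr_deriv ((hasDerivAt_id x).mul (hasDerivAt_exp_mul_sub t x)) ?_
    simp only [bopDensity, id]
    ring

theorem integral_mul_bopDensity {t : ℝ} (ht : 0 < t) :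
    ∫ x in (0 : ℝ)..1, bopDensity t x * x = 1 - 1 / t + (1 - Real.exp (-t)) / t ^ 2 := by
  rw [integral_eq_sub_of_continuousOn (f := fun x => bopDensity t x * x)
    (F := fun x => (x ^ 2 - x / t + 1 / t ^ 2) * Real.exp (t * (x - 1))) (fun x _ => ?_)
    ((continuous_bopDensity t).mul continuous_id).continuousOn]
  · simp
    ring
  · refine HasDerivAt.congr_deriv (((((hasDerivAt_id x).pow 2).sub
      ((hasDerivAt_id x).div_const t)).add_const (1 / t ^ 2)).mul (hasDerivAt_exp_mul_sub t x)) ?_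
    simp only [bopDensity, id, Pi.sub_apply, Pi.pow_apply]
    field_simp
    push_cast
    ring

theorem integral_tiltDensity {l : ℝ} (hl : 0 < l) : ∫ x in (0 : ℝ)..1, tiltDensity l x = 1 := by
  have h := exp_sub_one_pos hl
  rw [integral_eq_sub_of_continuousOn (F := fun x => Real.exp (l * x) / (Real.exp l - 1))
    (fun x _ => ?_) (continuous_tiltDensity l).continuousOn]
  · simp only [mul_one, mul_zero, Real.exp_zero]
    field_simp
  · refine HasDerivAt.congr_deriv ((hasDerivAt_exp_mul l x).div_const _) ?_
    simp only [tiltDensity]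
    ring

theorem integral_exp_mul {l : ℝ} (hl : 0 < l) :
    ∫ x in (0 : ℝ)..1, Real.exp (l * x) = (Real.exp l - 1) / l := by
  rw [integral_eq_sub_of_continuousOn (F := fun x => Real.exp (l * x) / l) (fun x _ => ?_)
    (by fun_prop)]
  · simp only [mul_one, mul_zero, Real.exp_zero]
    ring
  · refine HasDerivAt.congr_deriv ((hasDerivAt_exp_mul l x).div_const _) ?_
    field_simp

theorem integral_mul_tiltDensity {l : ℝ} (hl : 0 < l) :
    ∫ x in (0 : ℝ)..1, tiltDensity l x * x = Real.exp l / (Real.exp l - 1) - 1 / l := by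
  have h := exp_sub_one_pos hl
  rw [integral_eq_sub_of_continuousOn (f := fun x => tiltDensity l x * x)
    (F := fun x => (x - 1 / l) * Real.exp (l * x) / (Real.exp l - 1)) (fun x _ => ?_)
    ((continuous_tiltDensity l).mul continuous_id).continuousOn]
  · simp only [mul_one, mul_zero, Real.exp_zero]
    field_simp
    ring
  · refine HasDerivAt.congr_deriv ((((hasDerivAt_id x).sub_const (1 / l)).mul
      (hasDerivAt_exp_mul l x)).div_const _) ?_
    simp only [tiltDensity, id]
    field_simp
    ring

theorem integral_bopDensity_mul_log {t : ℝ} (ht : 0 < t) :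
    ∫ x in (0 : ℝ)..1, bopDensity t x * Real.log (1 + t * x) =
      Real.log (1 + t) - (1 - Real.exp (-t)) / t + Real.exp (-t) * expIntegral t / t := by
  have hpos : ∀ x ∈ Set.Icc (0 : ℝ) 1, 0 < 1 + t * x := fun x hx => by
    have := hx.1
    positivity
  rw [integral_eq_sub_of_continuousOn (f := fun x => bopDensity t x * Real.log (1 + t * x))
    -- Integration by parts, using that `x * exp (t * (x - 1))` is a primitive of `bopDensity t` and
    -- that `t * x / (1 + t * x) = 1 - 1 / (1 + t * x)`.
    (F := fun x => x * Real.exp (t * (x - 1)) * Real.log (1 + t * x) - Real.exp (t * (x - 1)) / t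
      + Real.exp (-t) * expIntegral (t * x) / t) (fun x hx => ?_) ?_]
  · simp [expIntegral_zero]
    ring
  · refine (continuous_bopDensity t).continuousOn.mul (ContinuousOn.log (by fun_prop) fun x hx => ?_)
    exact (hpos x hx).ne'
  · have h1 : HasDerivAt (fun x => Real.log (1 + t * x)) (t / (1 + t * x)) x := by
      have := (((hasDerivAt_id x).const_mul t).const_add 1).log (hpos x hx).ne'
      simpa using this
    have h2 : HasDerivAt (fun x => expIntegral (t * x)) (Real.exp (t * x) / (1 + t * x) * t) x := by
      have h3 := hasDerivAt_expIntegral (mul_nonneg ht.le hx.1)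
      exact HasDerivAt.congr_deriv (HasDerivAt.comp x h3 ((hasDerivAt_id x).const_mul t))
        (by rw [mul_one])
    refine HasDerivAt.congr_deriv (((((hasDerivAt_id x).mul (hasDerivAt_exp_mul_sub t x)).mul h1).sub
      ((hasDerivAt_exp_mul_sub t x).div_const t)).add ((h2.const_mul (Real.exp (-t))).div_const t)) ?_
    have e : Real.exp (t * (x - 1)) = Real.exp (-t) * Real.exp (t * x) := by
      rw [← Real.exp_add]
      congr 1
      ring
    have := (hpos x hx).ne'
    simp only [bopDensity, id, Pi.mul_apply, e]
    field_simp
    ring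

/-- The Kullback–Leibler divergence between two densities on `[0, 1]`. -/
noncomputable def klUnit (a b : ℝ → ℝ) : ℝ :=
  ∫ x in (0 : ℝ)..1, a x * (Real.log (a x) - Real.log (b x))

/-- The log-ratio of the densities is `log (1 + t * x)` plus an affine function of `x`, so mass,
mean and one logarithmic integral determine the divergence. -/
theorem klUnit_bop_tilt {t l : ℝ} (ht : 0 < t) (hl : 0 < l) :
    klUnit (bopDensity t) (tiltDensity l) =
      Real.exp (-t) * expIntegral t / t - (1 - Real.exp (-t)) / t
        + (l - t) * (1 / t - (1 - Real.exp (-t)) / t ^ 2)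
        + Real.log ((1 + t) * (1 - Real.exp (-l)) / l) := by
  have hl1 := exp_sub_one_pos hl
  have hlog : Real.log ((1 + t) * (1 - Real.exp (-l)) / l) =
      Real.log (1 + t) - l - Real.log (l / (Real.exp l - 1)) := by
    have e : (1 + t) * (1 - Real.exp (-l)) / l =
        (1 + t) * Real.exp (-l) / (l / (Real.exp l - 1)) := by
      have : Real.exp (-l) * Real.exp l = 1 := by
        rw [← Real.exp_add, neg_add_cancel, Real.exp_zero]
      rw [div_div_eq_mul_div, mul_assoc, mul_sub (Real.exp (-l)), this, mul_one]
    rw [e, Real.log_div (by positivity) (by positivity), Real.log_mul (by positivity)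
      (by positivity), Real.log_exp]
    ring
  have hi1 : IntervalIntegrable (fun x => bopDensity t x * Real.log (1 + t * x)) volume 0 1 := by
    refine ContinuousOn.intervalIntegrable ?_
    rw [Set.uIcc_of_le zero_le_one]
    refine (continuous_bopDensity t).continuousOn.mul (ContinuousOn.log (by fun_prop) fun x hx => ?_)
    have := hx.1
    positivity
  have hi2 : IntervalIntegrable (fun x => (t - l) * (bopDensity t x * x)) volume 0 1 :=
    (((continuous_bopDensity t).mul continuous_id).const_mul (t - l)).intervalIntegrable 0 1
  have hi3 : IntervalIntegrable (fun x => (-t - Real.log (l / (Real.exp l - 1))) * bopDensity t x)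
      volume 0 1 := ((continuous_bopDensity t).const_mul _).intervalIntegrable 0 1
  have e : klUnit (bopDensity t) (tiltDensity l) =
      ∫ x in (0 : ℝ)..1, (bopDensity t x * Real.log (1 + t * x) + (t - l) * (bopDensity t x * x)
        + (-t - Real.log (l / (Real.exp l - 1))) * bopDensity t x) := by
    refine intervalIntegral.integral_congr fun x hx => ?_
    rw [Set.uIcc_of_le zero_le_one] at hx
    rw [log_bopDensity ht hx.1, log_tiltDensity hl]
    ring
  rw [e, intervalIntegral.integral_add (hi1.add hi2) hi3, intervalIntegral.integral_add hi1 hi2,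
    intervalIntegral.integral_const_mul, intervalIntegral.integral_const_mul, integral_bopDensity,
    integral_mul_bopDensity ht, integral_bopDensity_mul_log ht, hlog]
  field_simp
  ring

/-! ### A tilt with divergence at most `8 * 10 ^ (-4)` -/

/-- Apply `log (1 + u) ≥ 2 * u / (u + 2)` at `u = 1 / z - 1`; what remains to check is `(1 - z) ^ 3
≥ 0`. -/
theorem log_le_sub_sq {z : ℝ} (h0 : 0 < z) (h1 : z ≤ 1) :
    Real.log z ≤ (z - 1) - (z - 1) ^ 2 / 2 := by
  have hz : 0 ≤ 1 / z - 1 := by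
    rw [sub_nonneg, le_div_iff₀ h0]
    linarith
  have h := Real.le_log_one_add_of_nonneg hz
  rw [add_sub_cancel, one_div, Real.log_inv] at h
  have e : 2 * (z⁻¹ - 1) / (z⁻¹ - 1 + 2) = 2 * (1 - z) / (1 + z) := by
    have hz2 : z⁻¹ - 1 + 2 ≠ 0 := by
      have := inv_pos.2 h0
      exact ne_of_gt (by linarith)
    rw [div_eq_div_iff hz2 (by positivity)]
    field_simp
    ring
  rw [e, div_le_iff₀ (by linarith)] at h
  have h3 : 0 ≤ (1 - z) ^ 3 := pow_nonneg (by linarith) 3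
  have : (1 + z) * Real.log z ≤ (1 + z) * ((z - 1) - (z - 1) ^ 2 / 2) := by nlinarith
  exact le_of_mul_le_mul_left this (by linarith)

theorem exists_klUnit_le_of_le {t : ℝ} (h0 : 3 / 8 ≤ t) (h1 : t ≤ 7) :
    ∃ l, 0 < l ∧ klUnit (bopDensity t) (tiltDensity l) ≤ 8 * (10 : ℝ) ^ (-4 : ℤ) := by
  have ht : 0 < t := by linarith
  have hw0 : 3 / 35 ≤ t / (t + 4) := by
    rw [div_le_div_iff₀ (by norm_num) (by positivity)]
    linarith
  obtain ⟨-, hw1⟩ := div_add_four_mem ht.le h1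
  obtain ⟨s, k, hs, hk0, hk, hgap, hN⟩ := exists_polyGap_nonneg hw0 hw1
  have hR := exp_neg_mul_expIntegral_le_polyR ht.le h1
  have hH := exp_neg_le_polyEhi ht.le h1
  have hL := polyElo_le_exp_neg ht.le h1
  have hs' : (0 : ℝ) < s := by exact_mod_cast hs
  have hk0' : (0 : ℝ) ≤ k := by exact_mod_cast hk0
  refine ⟨t + s, by positivity, ?_⟩
  rw [klUnit_bop_tilt ht (by positivity)]
  have hexp : Real.exp (-(t + s)) = Real.exp (-t) * Real.exp (-s) := by
    rw [← Real.exp_add]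
    congr 1
    ring
  have hexp1 : Real.exp (-(t + s)) < 1 := Real.exp_lt_one_iff.2 (by linarith)
  have htw : t = 4 * (t / (t + 4)) / (1 - t / (t + 4)) := by
    field_simp
    ring
  have hw0' : 0 < t / (t + 4) := by positivity
  have hw1' : 0 < 1 - t / (t + 4) := by linarith
  simp only [polyGap, polyN, polyL, polyV, polyEval_add, polyEval_mul, polyEval_smul, polyEval_cons,
    polyEval_nil] at hgap hN
  push_cast at hgap hN
  generalize t / (t + 4) = w at *
  generalize polyEval polyR w = R at *
  generalize polyEval polyEhi w = H at *
  generalize polyEval polyElo w = E at *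
  generalize Real.exp (-t) * expIntegral t = r at *
  -- The sign of the lower bound `E` of `exp (-t)` is not known, hence the two cases.
  have hkE : k * E ≤ Real.exp (-(t + s)) := by
    rw [hexp, mul_comm]
    rcases le_total 0 E with hE | hE
    · exact mul_le_mul hL hk hk0' (Real.exp_pos _).le
    · exact (mul_nonpos_of_nonpos_of_nonneg hE hk0').trans (by positivity)
  generalize Real.exp (-(t + s)) = q at *
  generalize Real.exp (-t) = e at *
  have hLpos : 0 < 4 * w + s * (1 - w) := by positivity
  -- `L = (1 - w) * (t + s)`, and `z` bounds the argument of the logarithm from above; `polyN` is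
  -- `(z - 1) * L`, so its sign gives `z ≤ 1`.
  obtain ⟨L, hLdef⟩ : ∃ L, L = 4 * w + s * (1 - w) := ⟨_, rfl⟩
  have hL0 : 0 < L := hLdef ▸ hLpos
  obtain ⟨z, hz⟩ : ∃ z, z = (1 + 3 * w) * (1 - k * E) / L := ⟨_, rfl⟩
  have hzL : z * L = (1 + 3 * w) * (1 - k * E) := by rw [hz, div_mul_cancel₀ _ hL0.ne']
  have hz0 : 0 < z := hz ▸ div_pos (mul_pos (by linarith) (by linarith)) hL0
  have hz1 : z ≤ 1 := by
    rw [hz, div_le_one hL0]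
    linarith
  have hlog : Real.log ((1 + t) * (1 - q) / (t + s)) ≤ (z - 1) - (z - 1) ^ 2 / 2 := by
    refine le_trans (Real.log_le_log ?_ ?_) (log_le_sub_sq hz0 hz1)
    · exact div_pos (mul_pos (by linarith) (by linarith)) (by linarith)
    · have e1 : (1 + t) * (1 - q) / (t + s) = (1 + 3 * w) * (1 - q) / L := by
        rw [div_eq_div_iff (by positivity) hL0.ne', hLdef, htw]
        field_simp
        ring
      rw [e1, hz]
      gcongr
  have hti : 1 / t = (1 - w) / (4 * w) := by
    rw [htw]
    field_simp
  have hmain : (R - 1 + s + H) * (1 / t) - s * (1 - H) * (1 / t) ^ 2 + ((z - 1) - (z - 1) ^ 2 / 2)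
      ≤ 8 * (10 : ℝ) ^ (-4 : ℤ) := by
    rw [hti]
    -- Multiplying by `16 * w ^ 2 * L ^ 2` clears all denominators and yields `polyGap`.
    have hpos : 0 < 16 * w ^ 2 * L ^ 2 := by positivity
    refine le_of_mul_le_mul_left ?_ hpos
    have e2 : 16 * w ^ 2 * L ^ 2 * ((R - 1 + s + H) * ((1 - w) / (4 * w))
        - s * (1 - H) * ((1 - w) / (4 * w)) ^ 2 + ((z - 1) - (z - 1) ^ 2 / 2)) =
        4 * (w * (1 - w) * L ^ 2 * (R - 1 + s + H)) - s * ((1 - w) ^ 2 * L ^ 2 * (1 - H))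
          + 16 * w ^ 2 * ((z * L - L) * L - (z * L - L) ^ 2 / 2) := by
      field_simp
      ring
    rw [e2, hzL]
    have e3 : (s : ℝ) + w * (4 - s + w * 0) = L := by rw [hLdef]; ring
    rw [e3] at hgap
    norm_num at hgap ⊢
    linarith
  have ht2 : 0 ≤ (1 / t) ^ 2 := by positivity
  have ht1 : 0 ≤ 1 / t := by positivity
  calc _ ≤ r / t - (1 - e) / t + (t + s - t) * (1 / t - (1 - e) / t ^ 2)
        + ((z - 1) - (z - 1) ^ 2 / 2) := by linarith
    _ = (r - 1 + s + e) * (1 / t) - s * (1 - e) * (1 / t) ^ 2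
        + ((z - 1) - (z - 1) ^ 2 / 2) := by
      field_simp
      ring
    _ ≤ (R - 1 + s + H) * (1 / t) - s * (1 - H) * (1 / t) ^ 2
        + ((z - 1) - (z - 1) ^ 2 / 2) := by
      gcongr
    _ ≤ _ := hmain

theorem exists_klUnit_le_of_ge {t : ℝ} (ht : 7 ≤ t) :
    ∃ l, 0 < l ∧ klUnit (bopDensity t) (tiltDensity l) ≤ 8 * (10 : ℝ) ^ (-4 : ℤ) := by
  have ht0 : 0 < t := by linarith
  -- The offset `1` matches the means to leading orders as `t → ∞`, and it reduces the logarithm to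
  -- `log (1 - exp (-(t + 1)))`, whose negative value absorbs the remaining `exp (-t)` terms.
  refine ⟨t + 1, by positivity, ?_⟩
  rw [klUnit_bop_tilt ht0 (by positivity)]
  have hr := exp_neg_mul_expIntegral_le_tail ht
  have hexp : Real.exp (-(t + 1)) = Real.exp (-t) * Real.exp (-1) := by
    rw [← Real.exp_add]
    congr 1
    ring
  have hexp1 : Real.exp (-(t + 1)) < 1 := Real.exp_lt_one_iff.2 (by linarith)
  have hlog : Real.log ((1 + t) * (1 - Real.exp (-(t + 1))) / (t + 1)) ≤
      -(Real.exp (-t) * Real.exp (-1)) := by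
    rw [add_comm 1 t, mul_div_cancel_left₀ _ (by positivity), ← hexp]
    exact (Real.log_le_sub_one_of_pos (by linarith)).trans (by linarith)
  have he1 : 1 / 3 ≤ Real.exp (-1) := by
    have := le_exp_neg (x := 1) zero_le_one le_rfl
    norm_num at this ⊢
    linarith
  have he0 := Real.exp_pos (-t)
  generalize Real.exp (-t) * expIntegral t = r at *
  generalize Real.exp (-t) = e at *
  have hy7 : 1 / (1 + t) ≤ 1 / 8 := one_div_le_one_div_of_le (by norm_num) (by linarith)
  have hy0 : 0 < 1 / (1 + t) := by positivity
  have htl : 1 / t ≤ 1 / 7 := one_div_le_one_div_of_le (by norm_num) ht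
  have ht1 : 0 < 1 / t := by positivity
  have hyt : (1 / (1 + t)) * (1 + 1 / t) = 1 / t := by
    field_simp
    ring
  generalize 1 / (1 + t) = y at *
  have hsq : (1 / t) ^ 2 ≤ 1 / 7 * (1 / 7) := by
    rw [sq]
    exact mul_le_mul htl htl ht1.le (by norm_num)
  have he2 : e * (1 / t + (1 / t) ^ 2) - e * Real.exp (-1) ≤ 0 := by
    rw [← mul_sub]
    exact mul_nonpos_of_nonneg_of_nonpos he0.le (by linarith)
  have e1 : r / t - (1 - e) / t + (t + 1 - t) * (1 / t - (1 - e) / t ^ 2) =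
      (r - 1 / t) * (1 / t) + e * (1 / t + (1 / t) ^ 2) := by
    field_simp
    ring
  have e2 : (r - 1 / t) * (1 / t) ≤ 8 * (10 : ℝ) ^ (-4 : ℤ) := by
    generalize 1 / t = x at *
    -- Here `x = y / (1 - y)`, whose geometric series starts with these terms; they cancel the tail
    -- bound up to `y ^ 3 * (1 + 12 * y)`.
    have hx : y + y ^ 2 + y ^ 3 ≤ x := by
      have h1 : x = y + y * x := by linarith
      have h2 : y ≤ x := by nlinarith
      nlinarith
    have h3 : r - x ≤ y ^ 3 * (1 + 12 * y) := by linarith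
    have h4 : y ^ 3 * (1 + 12 * y) ≤ (1 / 8) ^ 3 * (1 + 12 * (1 / 8)) := by gcongr
    have h5 : (r - x) * x ≤ (1 / 8) ^ 3 * (1 + 12 * (1 / 8)) * (1 / 7) :=
      (mul_le_mul_of_nonneg_right (h3.trans h4) ht1.le).trans
        (mul_le_mul_of_nonneg_left htl (by norm_num))
    norm_num at h5 ⊢
    linarith
  rw [e1]
  linarith

/-! ### Small `t`: comparison with the chi-square divergence -/

theorem klUnit_bop_tilt_le {t l : ℝ} (ht : 0 < t) (hl : 0 < l) :
    klUnit (bopDensity t) (tiltDensity l) ≤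
      ∫ x in (0 : ℝ)..1, bopDensity t x * (bopDensity t x / tiltDensity l x - 1) := by
  refine intervalIntegral.integral_mono_on zero_le_one ?_ ?_ fun x hx => ?_
  · refine ContinuousOn.intervalIntegrable ?_
    rw [Set.uIcc_of_le zero_le_one]
    exact (continuous_bopDensity t).continuousOn.mul
      (((continuous_bopDensity t).continuousOn.log fun x hx => (bopDensity_pos ht hx.1).ne').sub
        ((continuous_tiltDensity l).continuousOn.log fun x _ => (tiltDensity_pos hl x).ne'))
  · exact ((continuous_bopDensity t).mul (((continuous_bopDensity t).div (continuous_tiltDensity l)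
      fun x => (tiltDensity_pos hl x).ne').sub continuous_const)).intervalIntegrable 0 1
  · have hq := bopDensity_pos ht hx.1
    have hg := tiltDensity_pos hl x
    rw [← Real.log_div hq.ne' hg.ne']
    exact mul_le_mul_of_nonneg_left (Real.log_le_sub_one_of_pos (div_pos hq hg)) hq.le

/-- At `l = 2 * t` the exponentials in the squared density and in the tilt cancel, leaving the
polynomial `(1 + t * x) ^ 2` times a constant. -/
theorem integral_bopDensity_mul_div {t : ℝ} (ht : 0 < t) :
    ∫ x in (0 : ℝ)..1, bopDensity t x * (bopDensity t x / tiltDensity (2 * t) x - 1) =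
      (1 - Real.exp (-(2 * t))) / (2 * t) * (1 + t + t ^ 2 / 3) - 1 := by
  have hl : 0 < 2 * t := by positivity
  have e : ∀ x, bopDensity t x * (bopDensity t x / tiltDensity (2 * t) x - 1) =
      (1 - Real.exp (-(2 * t))) / (2 * t) * (1 + t * x) ^ 2 - bopDensity t x := fun x => by
    have h1 := (exp_sub_one_pos hl).ne'
    have e1 : Real.exp (t * (x - 1)) ^ 2 = Real.exp (2 * t * x) * Real.exp (-(2 * t)) := by
      rw [← Real.exp_nat_mul, ← Real.exp_add]
      congr 1
      push_cast
      ring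
    have e2 : Real.exp (-(2 * t)) * (Real.exp (2 * t) - 1) = 1 - Real.exp (-(2 * t)) := by
      rw [mul_sub, ← Real.exp_add, neg_add_cancel, Real.exp_zero, mul_one]
    have e3 := (Real.exp_pos (2 * t * x)).ne'
    rw [← e2, mul_sub, mul_one, mul_div_assoc', ← sq]
    simp only [tiltDensity, bopDensity, mul_pow, e1]
    field_simp
  have hi : IntervalIntegrable
      (fun x => (1 - Real.exp (-(2 * t))) / (2 * t) * (1 + t * x) ^ 2) volume 0 1 :=
    Continuous.intervalIntegrable (by fun_prop) 0 1
  have hp : ∫ x in (0 : ℝ)..1, (1 + t * x) ^ 2 = 1 + t + t ^ 2 / 3 := by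
    rw [integral_eq_sub_of_continuousOn (F := fun x => x + t * x ^ 2 + t ^ 2 / 3 * x ^ 3)
      (fun x _ => ?_) (by fun_prop)]
    · ring
    · refine HasDerivAt.congr_deriv (((hasDerivAt_id x).add (((hasDerivAt_id x).pow 2).const_mul
        t)).add (((hasDerivAt_id x).pow 3).const_mul (t ^ 2 / 3))) ?_
      simp only [id]
      push_cast
      ring
  simp only [e]
  rw [intervalIntegral.integral_sub hi ((continuous_bopDensity t).intervalIntegrable 0 1),
    intervalIntegral.integral_const_mul, hp, integral_bopDensity]

theorem exists_klUnit_le_of_small {t : ℝ} (h0 : 0 < t) (h1 : t ≤ 3 / 8) :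
    ∃ l, 0 < l ∧ klUnit (bopDensity t) (tiltDensity l) ≤ 8 * (10 : ℝ) ^ (-4 : ℤ) := by
  -- The means are `1 / 2 + t / 6` and `1 / 2 + l / 12` to first order, whence `l = 2 * t`.
  refine ⟨2 * t, by positivity, (klUnit_bop_tilt_le h0 (by positivity)).trans ?_⟩
  rw [integral_bopDensity_mul_div h0]
  have h := le_exp_neg (x := 2 * t) (by positivity) (by linarith)
  have h2 : (1 - Real.exp (-(2 * t))) / (2 * t) ≤
      1 - t + 2 * t ^ 2 / 3 - t ^ 3 / 3 + 2 * t ^ 4 / 15 := by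
    rw [div_le_iff₀ (by positivity)]
    linarith
  have h3 : (1 - Real.exp (-(2 * t))) / (2 * t) * (1 + t + t ^ 2 / 3) ≤
      (1 - t + 2 * t ^ 2 / 3 - t ^ 3 / 3 + 2 * t ^ 4 / 15) * (1 + t + t ^ 2 / 3) :=
    mul_le_mul_of_nonneg_right h2 (by positivity)
  -- In the product of the two polynomials all terms of degree one to three cancel; what exceeds `1`
  -- is exactly `t ^ 4 * (1 + t + 2 * t ^ 2) / 45`.
  have h4 : t ^ 4 * (1 + t + 2 * t ^ 2) / 45 ≤ (3 / 8) ^ 4 * (1 + 3 / 8 + 2 * (3 / 8) ^ 2) / 45 := by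
    gcongr
  norm_num at h4 ⊢
  linarith

/-- Every Best-of-Poisson density has divergence at most `8 * 10 ^ (-4)` from some tilt. -/
theorem exists_klUnit_le {t : ℝ} (ht : 0 < t) :
    ∃ l, 0 < l ∧ klUnit (bopDensity t) (tiltDensity l) ≤ 8 * (10 : ℝ) ^ (-4 : ℤ) := by
  rcases le_total t (3 / 8) with h | h
  · exact exists_klUnit_le_of_small ht h
  rcases le_total t 7 with h' | h'
  · exact exists_klUnit_le_of_le h h'
  · exact exists_klUnit_le_of_ge h'

/-! ### The law of the best of finitely many samples -/

section Law

variable {X : Type*} [MeasurableSpace X] {ref : Measure X} {r : X → ℝ}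

theorem map_reward (hunif : pdf.IsUniform r (Set.Icc (0 : ℝ) 1) ref volume) :
    ref.map r = volume.restrict (Set.Icc 0 1) := by
  have h : ref.map r = ProbabilityTheory.cond volume (Set.Icc (0 : ℝ) 1) := hunif
  rw [h, ProbabilityTheory.cond, Real.volume_Icc]
  simp

theorem ae_reward_mem (hr : Measurable r)
    (hunif : pdf.IsUniform r (Set.Icc (0 : ℝ) 1) ref volume) :
    ∀ᵐ x ∂ref, r x ∈ Set.Icc (0 : ℝ) 1 := by
  refine ae_of_ae_map hr.aemeasurable (p := fun y => y ∈ Set.Icc (0 : ℝ) 1) ?_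
  rw [map_reward hunif]
  exact ae_restrict_mem measurableSet_Icc

theorem measure_reward_le (hr : Measurable r)
    (hunif : pdf.IsUniform r (Set.Icc (0 : ℝ) 1) ref volume) {c : ℝ} (hc : c ∈ Set.Icc (0 : ℝ) 1) :
    ref {x | r x ≤ c} = ENNReal.ofReal c := by
  have h : ref {x | r x ≤ c} = ref.map r (Set.Iic c) := (Measure.map_apply hr measurableSet_Iic).symm
  rw [h, map_reward hunif, Measure.restrict_apply measurableSet_Iic]
  have e : Set.Iic c ∩ Set.Icc 0 1 = Set.Icc 0 c := by
    ext y
    simp only [Set.mem_inter_iff, Set.mem_Iic, Set.mem_Icc]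
    exact ⟨fun h => ⟨h.2.1, h.1⟩, fun h => ⟨h.2, h.1, h.2.trans hc.2⟩⟩
  rw [e, Real.volume_Icc, sub_zero]

theorem setLIntegral_pow_lt (hr : Measurable r)
    (hunif : pdf.IsUniform r (Set.Icc (0 : ℝ) 1) ref volume) (n : ℕ) {c : ℝ}
    (hc : c ∈ Set.Icc (0 : ℝ) 1) :
    ∫⁻ x in {x | r x < c}, ENNReal.ofReal ((n + 1) * r x ^ n) ∂ref = ENNReal.ofReal (c ^ (n + 1)) := by
  have hm : Measurable fun y : ℝ => ENNReal.ofReal ((n + 1) * y ^ n) := by fun_prop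
  have h : ∫⁻ x in {x | r x < c}, ENNReal.ofReal ((n + 1) * r x ^ n) ∂ref =
      ∫⁻ y in Set.Iio c, ENNReal.ofReal ((n + 1) * y ^ n) ∂(ref.map r) :=
    (setLIntegral_map measurableSet_Iio hm hr).symm
  have e : Set.Iio c ∩ Set.Icc 0 1 = Set.Ico 0 c := by
    ext y
    simp only [Set.mem_inter_iff, Set.mem_Iio, Set.mem_Icc, Set.mem_Ico]
    exact ⟨fun h => ⟨h.2.1, h.1⟩, fun h => ⟨h.2, h.1, h.2.le.trans hc.2⟩⟩
  rw [h, map_reward hunif, Measure.restrict_restrict measurableSet_Iio, e,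
    Measure.restrict_congr_set (Ioo_ae_eq_Ico.symm.trans Ioo_ae_eq_Ioc),
    ← ofReal_integral_eq_lintegral_ofReal, ← intervalIntegral.integral_of_le hc.1]
  · rw [intervalIntegral.integral_const_mul, integral_pow]
    congr 1
    field_simp
    simp
  · exact (Continuous.integrableOn_Icc (by fun_prop)).mono_set Set.Ioc_subset_Icc_self
  · refine (ae_restrict_mem measurableSet_Ioc).mono fun y hy => ?_
    have := hy.1.le
    positivity

/-- The best of samples `0, …, n` depends on those samples only, so it is independent of sample `n +
1`. -/
theorem map_bestOf_prod [IsProbabilityMeasure ref] (hr : Measurable r) (n : ℕ) :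
    (Measure.infinitePi fun _ : ℕ => ref).map (fun x => (bestOf r n x, x (n + 1))) =
      ((Measure.infinitePi fun _ : ℕ => ref).map (bestOf r n)).prod ref := by
  have hind : iIndepFun (fun (i : ℕ) (x : ℕ → X) => x i) (Measure.infinitePi fun _ : ℕ => ref) :=
    iIndepFun_infinitePi (X := fun _ x => x) fun _ => measurable_id
  have h2 := hind.indepFun_finset (Finset.range (n + 1)) {n + 1} (by simp) measurable_pi_apply
  -- A finite vector is padded to a sequence with its entry `0`; `bestOf r n` never reads the
  -- padding.
  have hg : Measurable fun (v : Finset.range (n + 1) → X) (i : ℕ) =>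
      if h : i ∈ Finset.range (n + 1) then v ⟨i, h⟩ else v ⟨0, by simp⟩ := by
    refine measurable_pi_lambda _ fun i => ?_
    by_cases h : i ∈ Finset.range (n + 1)
    · simpa [h] using measurable_pi_apply _
    · simpa [h] using measurable_pi_apply _
  have h3 := h2.comp ((measurable_bestOf hr n).comp hg)
    (measurable_pi_apply (⟨n + 1, by simp⟩ : ({n + 1} : Finset ℕ)))
  have hcongr : ∀ (m : ℕ) (x y : ℕ → X), (∀ i ≤ m, x i = y i) → bestOf r m x = bestOf r m y := by
    intro m
    induction m with
    | zero => exact fun x y h => h 0 le_rfl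
    | succ m ih =>
      intro x y h
      simp only [bestOf, ih x y fun i hi => h i (hi.trans m.le_succ), h (m + 1) le_rfl]
  have e : ((bestOf r n ∘ fun (v : Finset.range (n + 1) → X) (i : ℕ) =>
      if h : i ∈ Finset.range (n + 1) then v ⟨i, h⟩ else v ⟨0, by simp⟩) ∘
      fun (x : ℕ → X) (i : Finset.range (n + 1)) => x i) = bestOf r n := by
    funext x
    refine hcongr n _ _ fun i hi => ?_
    simp [Nat.lt_succ_of_le hi]
  rw [e] at h3
  have h4 := (indepFun_iff_map_prod_eq_prod_map_map (measurable_bestOf hr n).aemeasurable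
    (measurable_pi_apply (n + 1)).aemeasurable).1 h3
  rwa [Measure.infinitePi_map_eval] at h4

/-- Induction step: at reward `ρ` the new sample wins with probability `ρ ^ (n + 1)`, and the old
best, of density `(n + 1) * ρ ^ n`, survives with probability `ρ`. The sum is `(n + 2) * ρ ^ (n +
1)`. Ties go to the old best, hence one strict and one weak inequality. -/
theorem map_bestOf [IsProbabilityMeasure ref] (hr : Measurable r)
    (hunif : pdf.IsUniform r (Set.Icc (0 : ℝ) 1) ref volume) (n : ℕ) :
    (Measure.infinitePi fun _ : ℕ => ref).map (bestOf r n) =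
      ref.withDensity fun x => ENNReal.ofReal ((n + 1) * r x ^ n) := by
  induction n with
  | zero =>
    have e : bestOf r 0 = fun x : ℕ → X => x 0 := rfl
    rw [e, Measure.infinitePi_map_eval]
    simp
  | succ n ih =>
    have hφ : Measurable fun p : X × X => if r p.1 < r p.2 then p.2 else p.1 :=
      Measurable.ite (measurableSet_lt (hr.comp measurable_fst) (hr.comp measurable_snd))
        measurable_snd measurable_fst
    have hm : Measurable fun x : X => ENNReal.ofReal ((n + 1) * r x ^ n) := by fun_prop
    have e : bestOf r (n + 1) = (fun p : X × X => if r p.1 < r p.2 then p.2 else p.1) ∘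
        fun x : ℕ → X => (bestOf r n x, x (n + 1)) := rfl
    rw [e, ← Measure.map_map hφ ((measurable_bestOf hr n).prodMk (measurable_pi_apply (n + 1))),
      map_bestOf_prod hr, ih]
    have : IsProbabilityMeasure (ref.withDensity fun x => ENNReal.ofReal ((n + 1) * r x ^ n)) := by
      rw [← ih]
      exact Measure.isProbabilityMeasure_map (measurable_bestOf hr n).aemeasurable
    ext A hA
    rw [Measure.map_apply hφ hA, withDensity_apply _ hA]
    have hS : (fun p : X × X => if r p.1 < r p.2 then p.2 else p.1) ⁻¹' A =
        {p | r p.1 < r p.2 ∧ p.2 ∈ A} ∪ {p | r p.2 ≤ r p.1 ∧ p.1 ∈ A} := by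
      ext p
      by_cases hp : r p.1 < r p.2
      · simp [hp]
      · simp [hp, not_lt.1 hp]
    have hlt : MeasurableSet {p : X × X | r p.1 < r p.2} :=
      measurableSet_lt (hr.comp measurable_fst) (hr.comp measurable_snd)
    have hle : MeasurableSet {p : X × X | r p.2 ≤ r p.1} :=
      measurableSet_le (hr.comp measurable_snd) (hr.comp measurable_fst)
    have hS1 : MeasurableSet {p : X × X | r p.1 < r p.2 ∧ p.2 ∈ A} :=
      hlt.inter (measurable_snd hA)
    have hS2 : MeasurableSet {p : X × X | r p.2 ≤ r p.1 ∧ p.1 ∈ A} :=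
      hle.inter (measurable_fst hA)
    have hdisj : Disjoint {p : X × X | r p.1 < r p.2 ∧ p.2 ∈ A}
        {p : X × X | r p.2 ≤ r p.1 ∧ p.1 ∈ A} :=
      Set.disjoint_left.2 fun p h1 h2 => absurd h1.1 (not_lt.2 h2.1)
    rw [hS, measure_union hdisj hS2, Measure.prod_apply_symm hS1, Measure.prod_apply hS2]
    have hmem := ae_reward_mem hr hunif
    have e1 : ∫⁻ b, (ref.withDensity fun x => ENNReal.ofReal ((n + 1) * r x ^ n))
        ((fun a => (a, b)) ⁻¹' {p : X × X | r p.1 < r p.2 ∧ p.2 ∈ A}) ∂ref =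
        ∫⁻ b in A, ENNReal.ofReal (r b ^ (n + 1)) ∂ref := by
      rw [← lintegral_indicator hA]
      refine lintegral_congr_ae (hmem.mono fun b hb => ?_)
      by_cases hbA : b ∈ A
      · have : (fun a => (a, b)) ⁻¹' {p : X × X | r p.1 < r p.2 ∧ p.2 ∈ A} = {x | r x < r b} := by
          ext a
          simp [hbA]
        simp only [this, Set.indicator_of_mem hbA]
        rw [withDensity_apply _ (measurableSet_lt hr measurable_const),
          setLIntegral_pow_lt hr hunif n hb]
      · have : (fun a => (a, b)) ⁻¹' {p : X × X | r p.1 < r p.2 ∧ p.2 ∈ A} = ∅ := by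
          ext a
          simp [hbA]
        simp only [this, Set.indicator_of_notMem hbA, measure_empty]
    have e2 : ∫⁻ a, ref (Prod.mk a ⁻¹' {p : X × X | r p.2 ≤ r p.1 ∧ p.1 ∈ A})
        ∂(ref.withDensity fun x => ENNReal.ofReal ((n + 1) * r x ^ n)) =
        ∫⁻ a in A, ENNReal.ofReal ((n + 1) * r a ^ (n + 1)) ∂ref := by
      rw [lintegral_withDensity_eq_lintegral_mul _ hm (measurable_measure_prodMk_left hS2),
        ← lintegral_indicator hA]
      refine lintegral_congr_ae (hmem.mono fun a ha => ?_)
      by_cases haA : a ∈ A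
      · have : Prod.mk a ⁻¹' {p : X × X | r p.2 ≤ r p.1 ∧ p.1 ∈ A} = {x | r x ≤ r a} := by
          ext b
          simp [haA]
        simp only [Pi.mul_apply, this, Set.indicator_of_mem haA]
        have ha0 := ha.1
        rw [measure_reward_le hr hunif ha, ← ENNReal.ofReal_mul (by positivity)]
        congr 1
        ring
      · have : Prod.mk a ⁻¹' {p : X × X | r p.2 ≤ r p.1 ∧ p.1 ∈ A} = ∅ := by
          ext b
          simp [haA]
        simp only [Pi.mul_apply, this, Set.indicator_of_notMem haA, measure_empty, mul_zero]
    rw [e1, e2, ← lintegral_add_left (by fun_prop)]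
    refine lintegral_congr_ae (ae_restrict_of_ae (hmem.mono fun a ha => ?_))
    have ha0 := ha.1
    simp only
    rw [← ENNReal.ofReal_add (by positivity) (by positivity)]
    congr 1
    push_cast
    ring

theorem hasSum_succ_mul_pow_div_factorial (y : ℝ) :
    HasSum (fun n : ℕ => (n + 1) * (y ^ n / n.factorial)) ((1 + y) * Real.exp y) := by
  have h1 : HasSum (fun n : ℕ => y ^ n / n.factorial) (Real.exp y) := by
    rw [Real.exp_eq_exp_ℝ]
    exact NormedSpace.expSeries_div_hasSum_exp y
  have h2 : HasSum (fun n : ℕ => n * (y ^ n / n.factorial)) (y * Real.exp y) := by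
    have := (hasSum_nat_add_iff (f := fun n : ℕ => n * (y ^ n / n.factorial)) 1
      (g := y * Real.exp y)).1
    simp only [Finset.range_one, Finset.sum_singleton, Nat.cast_zero, zero_mul, add_zero] at this
    refine this ((h1.mul_left y).congr_fun ?_)
    intro n
    rw [Nat.factorial_succ, pow_succ]
    push_cast
    field_simp
  convert! h2.add h1 using 1
  · funext n
    ring
  · ring

theorem bopLaw_eq_withDensity [IsProbabilityMeasure ref] (hr : Measurable r)
    (hunif : pdf.IsUniform r (Set.Icc (0 : ℝ) 1) ref volume) (μ : ℝ≥0) :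
    bopLaw ref r μ = ref.withDensity fun x => ENNReal.ofReal (bopDensity μ (r x)) := by
  ext A hA
  rw [bopLaw, Measure.map_apply (measurable_bestOf_uncurry hr) hA,
    Measure.prod_apply (measurable_bestOf_uncurry hr hA), withDensity_apply _ hA]
  have e1 : ∀ n : ℕ, (Measure.infinitePi fun _ : ℕ => ref)
      (Prod.mk n ⁻¹' ((fun p : ℕ × (ℕ → X) => bestOf r p.1 p.2) ⁻¹' A)) =
      ∫⁻ x in A, ENNReal.ofReal ((n + 1) * r x ^ n) ∂ref := fun n => by
    rw [← withDensity_apply _ hA, ← map_bestOf hr hunif n,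
      Measure.map_apply (measurable_bestOf hr n) hA]
    rfl
  simp only [e1]
  rw [poissonMeasure, lintegral_sum_measure]
  simp only [lintegral_smul_measure, lintegral_dirac, smul_eq_mul]
  have e2 : ∀ n : ℕ, ENNReal.ofReal (Real.exp (-μ) * μ ^ n / n.factorial) *
      ∫⁻ x in A, ENNReal.ofReal ((n + 1) * r x ^ n) ∂ref =
      ∫⁻ x in A, ENNReal.ofReal (Real.exp (-μ) * μ ^ n / n.factorial) *
        ENNReal.ofReal ((n + 1) * r x ^ n) ∂ref := fun n =>
    (lintegral_const_mul _ (by fun_prop)).symm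
  simp only [e2]
  rw [← lintegral_tsum fun n => by fun_prop]
  refine lintegral_congr_ae (ae_restrict_of_ae ((ae_reward_mem hr hunif).mono fun x hx => ?_))
  have hx0 := hx.1
  have hs : HasSum (fun n : ℕ => Real.exp (-μ) * μ ^ n / n.factorial * ((n + 1) * r x ^ n))
      (bopDensity μ (r x)) := by
    convert! (hasSum_succ_mul_pow_div_factorial (μ * r x)).mul_left (Real.exp (-μ)) using 1
    · funext n
      rw [mul_pow]
      ring
    · have : Real.exp (μ * (r x - 1)) = Real.exp (-μ) * Real.exp (μ * r x) := by
        rw [← Real.exp_add]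
        congr 1
        ring
      rw [bopDensity, this]
      ring
  simp only
  rw [← hs.tsum_eq, ENNReal.ofReal_tsum_of_nonneg (fun n => by positivity) hs.summable]
  exact tsum_congr fun n => (ENNReal.ofReal_mul (by positivity)).symm

end Law

/-! ### Divergences between laws with densities in the reward -/

/-- A continuous positive probability density on `[0, 1]`. -/
structure IsUnitDensity (a : ℝ → ℝ) : Prop where
  continuous : Continuous a
  pos : ∀ x ∈ Set.Icc (0 : ℝ) 1, 0 < a x
  integral : ∫ x in (0 : ℝ)..1, a x = 1

theorem isUnitDensity_bop {t : ℝ} (ht : 0 < t) : IsUnitDensity (bopDensity t) :=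
  ⟨continuous_bopDensity t, fun _ hx => bopDensity_pos ht hx.1, integral_bopDensity t⟩

theorem isUnitDensity_tilt {l : ℝ} (hl : 0 < l) : IsUnitDensity (tiltDensity l) :=
  ⟨continuous_tiltDensity l, fun x _ => tiltDensity_pos hl x, integral_tiltDensity hl⟩

theorem isUnitDensity_one : IsUnitDensity fun _ => 1 :=
  ⟨continuous_const, fun _ _ => one_pos, by simp⟩

theorem IsUnitDensity.continuousOn_log {a : ℝ → ℝ} (ha : IsUnitDensity a) :
    ContinuousOn (fun x => Real.log (a x)) (Set.Icc 0 1) :=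
  ha.continuous.continuousOn.log fun x hx => (ha.pos x hx).ne'

section Divergence

variable {X : Type*} [MeasurableSpace X] {ref : Measure X} {r : X → ℝ}

theorem integral_reward (hr : Measurable r)
    (hunif : pdf.IsUniform r (Set.Icc (0 : ℝ) 1) ref volume) {f : ℝ → ℝ} (hf : Measurable f) :
    ∫ x, f (r x) ∂ref = ∫ x in (0 : ℝ)..1, f x := by
  rw [← integral_map hr.aemeasurable hf.aestronglyMeasurable, map_reward hunif,
    integral_Icc_eq_integral_Ioc, intervalIntegral.integral_of_le zero_le_one]

theorem integral_withDensity_reward (hr : Measurable r)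
    (hunif : pdf.IsUniform r (Set.Icc (0 : ℝ) 1) ref volume) {a : ℝ → ℝ} (ha : IsUnitDensity a)
    {f : ℝ → ℝ} (hf : Measurable f) :
    ∫ x, f (r x) ∂(ref.withDensity fun x => ENNReal.ofReal (a (r x))) =
      ∫ x in (0 : ℝ)..1, a x * f x := by
  have hm : Measurable fun x => ENNReal.ofReal (a (r x)) :=
    (ha.continuous.measurable.comp hr).ennreal_ofReal
  rw [integral_withDensity_eq_integral_toReal_smul hm (by simp),
    ← integral_reward hr hunif (f := fun x => a x * f x) (ha.continuous.measurable.mul hf)]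
  refine integral_congr_ae ((ae_reward_mem hr hunif).mono fun x hx => ?_)
  simp only [smul_eq_mul]
  rw [ENNReal.toReal_ofReal (ha.pos _ hx).le]

theorem isProbabilityMeasure_withDensity_reward [IsProbabilityMeasure ref] (hr : Measurable r)
    (hunif : pdf.IsUniform r (Set.Icc (0 : ℝ) 1) ref volume) {a : ℝ → ℝ} (ha : IsUnitDensity a) :
    IsProbabilityMeasure (ref.withDensity fun x => ENNReal.ofReal (a (r x))) := by
  refine ⟨?_⟩
  have hm : Measurable fun x => ENNReal.ofReal (a x) := ha.continuous.measurable.ennreal_ofReal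
  rw [withDensity_apply _ MeasurableSet.univ, Measure.restrict_univ,
    ← lintegral_map (f := fun x => ENNReal.ofReal (a x)) hm hr, map_reward hunif,
    ← ofReal_integral_eq_lintegral_ofReal, integral_Icc_eq_integral_Ioc,
    ← intervalIntegral.integral_of_le zero_le_one, ha.integral, ENNReal.ofReal_one]
  · exact ha.continuous.integrableOn_Icc
  · exact (ae_restrict_mem measurableSet_Icc).mono fun x hx => (ha.pos x hx).le

/-- The log-ratio is continuous on the compact `[0, 1]`, hence bounded and integrable. Both measures
have mass one, so the mass correction in `klDiv` vanishes. -/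
theorem klDiv_withDensity_reward [IsProbabilityMeasure ref] (hr : Measurable r)
    (hunif : pdf.IsUniform r (Set.Icc (0 : ℝ) 1) ref volume) {a b : ℝ → ℝ} (ha : IsUnitDensity a)
    (hb : IsUnitDensity b) :
    klDiv (ref.withDensity fun x => ENNReal.ofReal (a (r x)))
      (ref.withDensity fun x => ENNReal.ofReal (b (r x))) ≠ ∞ ∧
    (klDiv (ref.withDensity fun x => ENNReal.ofReal (a (r x)))
      (ref.withDensity fun x => ENNReal.ofReal (b (r x)))).toReal = klUnit a b := by
  have hmem := ae_reward_mem hr hunif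
  have hab : Measurable fun x => ENNReal.ofReal (a (r x) / b (r x)) :=
    ((ha.continuous.measurable.comp hr).div (hb.continuous.measurable.comp hr)).ennreal_ofReal
  have hbm : Measurable fun x => ENNReal.ofReal (b (r x)) :=
    (hb.continuous.measurable.comp hr).ennreal_ofReal
  have hPa := isProbabilityMeasure_withDensity_reward hr hunif ha
  have hPb := isProbabilityMeasure_withDensity_reward hr hunif hb
  have hrn : ref.withDensity (fun x => ENNReal.ofReal (a (r x))) =
      (ref.withDensity fun x => ENNReal.ofReal (b (r x))).withDensity
        fun x => ENNReal.ofReal (a (r x) / b (r x)) := by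
    rw [← withDensity_mul _ hbm hab]
    refine withDensity_congr_ae (hmem.mono fun x hx => ?_)
    simp only [Pi.mul_apply]
    rw [← ENNReal.ofReal_mul (hb.pos _ hx).le, mul_div_cancel₀ _ (hb.pos _ hx).ne']
  have hmem' : ∀ᵐ x ∂(ref.withDensity fun x => ENNReal.ofReal (a (r x))), r x ∈ Set.Icc (0 : ℝ) 1 :=
    (withDensity_absolutelyContinuous ref _).ae_le hmem
  have hac : ref.withDensity (fun x => ENNReal.ofReal (a (r x))) ≪
      ref.withDensity fun x => ENNReal.ofReal (b (r x)) := by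
    rw [hrn]
    exact withDensity_absolutelyContinuous _ _
  have hd : (ref.withDensity fun x => ENNReal.ofReal (a (r x))).rnDeriv
      (ref.withDensity fun x => ENNReal.ofReal (b (r x)))
      =ᵐ[ref.withDensity fun x => ENNReal.ofReal (a (r x))]
        fun x => ENNReal.ofReal (a (r x) / b (r x)) := by
    have h := Measure.rnDeriv_withDensity (ref.withDensity fun x => ENNReal.ofReal (b (r x))) hab
    rw [← hrn] at h
    exact hac.ae_le h
  have hllr : llr (ref.withDensity fun x => ENNReal.ofReal (a (r x)))
      (ref.withDensity fun x => ENNReal.ofReal (b (r x)))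
      =ᵐ[ref.withDensity fun x => ENNReal.ofReal (a (r x))]
        fun x => Real.log (a (r x)) - Real.log (b (r x)) := by
    filter_upwards [hd, hmem'] with x hx hx'
    have h1 := ha.pos _ hx'
    have h2 := hb.pos _ hx'
    rw [llr, hx, ENNReal.toReal_ofReal (div_pos h1 h2).le, Real.log_div h1.ne' h2.ne']
  have hlogm : Measurable fun x => Real.log (a x) - Real.log (b x) :=
    ha.continuous.measurable.log.sub hb.continuous.measurable.log
  have hint : Integrable (fun x => Real.log (a (r x)) - Real.log (b (r x)))
      (ref.withDensity fun x => ENNReal.ofReal (a (r x))) := by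
    obtain ⟨C, hC⟩ := isCompact_Icc.exists_bound_of_continuousOn
      (ha.continuousOn_log.sub hb.continuousOn_log)
    exact Integrable.of_bound (hlogm.comp hr).aestronglyMeasurable C
      (hmem'.mono fun x hx => hC _ hx)
  refine ⟨klDiv_ne_top hac (hint.congr hllr.symm), ?_⟩
  rw [toReal_klDiv_of_measure_eq hac (by simp only [measure_univ]), integral_congr_ae hllr,
    integral_withDensity_reward hr hunif ha hlogm, klUnit]

theorem tiltLaw_eq_withDensity (hr : Measurable r)
    (hunif : pdf.IsUniform r (Set.Icc (0 : ℝ) 1) ref volume) {l : ℝ} (hl : 0 < l) :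
    tiltLaw ref r l = ref.withDensity fun x => ENNReal.ofReal (tiltDensity l (r x)) := by
  rw [tiltLaw, Measure.tilted,
    integral_reward hr hunif (f := fun x => Real.exp (l * x)) (by fun_prop), integral_exp_mul hl]
  congr 1
  funext x
  rw [tiltDensity, div_div_eq_mul_div, mul_comm]

end Divergence

/-! ### Mean rewards -/

/-- The source of the Pythagorean identity: the density `a` enters only through its mean. -/
theorem integral_mul_log_tiltDensity {a : ℝ → ℝ} (ha : IsUnitDensity a) {l : ℝ} (hl : 0 < l) :
    ∫ x in (0 : ℝ)..1, a x * Real.log (tiltDensity l x) =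
      l * (∫ x in (0 : ℝ)..1, a x * x) + Real.log (l / (Real.exp l - 1)) := by
  have e : ∀ x, a x * Real.log (tiltDensity l x) =
      l * (a x * x) + Real.log (l / (Real.exp l - 1)) * a x := fun x => by
    rw [log_tiltDensity hl]
    ring
  simp only [e]
  rw [intervalIntegral.integral_add, intervalIntegral.integral_const_mul,
    intervalIntegral.integral_const_mul, ha.integral, mul_one]
  · exact ((ha.continuous.mul continuous_id).const_mul l).intervalIntegrable 0 1
  · exact (ha.continuous.const_mul _).intervalIntegrable 0 1

theorem klUnit_eq_sub {a b : ℝ → ℝ} (ha : IsUnitDensity a) (hb : IsUnitDensity b) :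
    klUnit a b = (∫ x in (0 : ℝ)..1, a x * Real.log (a x)) -
      ∫ x in (0 : ℝ)..1, a x * Real.log (b x) := by
  have hi : ∀ {c : ℝ → ℝ}, IsUnitDensity c →
      IntervalIntegrable (fun x => a x * Real.log (c x)) volume 0 1 := fun hc => by
    refine ContinuousOn.intervalIntegrable ?_
    rw [Set.uIcc_of_le zero_le_one]
    exact ha.continuous.continuousOn.mul hc.continuousOn_log
  rw [klUnit, ← intervalIntegral.integral_sub (hi ha) (hi hb)]
  exact intervalIntegral.integral_congr fun x _ => mul_sub _ _ _

/-- The mean of the Best-of-Poisson density. -/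
noncomputable def bopMean (t : ℝ) : ℝ := ∫ x in (0 : ℝ)..1, bopDensity t x * x

/-- The mean of the tilt density. -/
noncomputable def tiltMean (l : ℝ) : ℝ := ∫ x in (0 : ℝ)..1, tiltDensity l x * x

theorem half_lt_bopMean {t : ℝ} (ht : 0 < t) : 1 / 2 < bopMean t := by
  rw [bopMean, integral_mul_bopDensity ht]
  have h := Real.quadratic_le_exp_of_nonneg ht.le
  have h1 : Real.exp (-t) * Real.exp t = 1 := by
    rw [← Real.exp_add, neg_add_cancel, Real.exp_zero]
  -- Uses `(1 - t + t ^ 2 / 2) * (1 + t + t ^ 2 / 2) = 1 + t ^ 4 / 4 > 1`.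
  have h2 : Real.exp (-t) < 1 - t + t ^ 2 / 2 := by
    by_contra hc
    rw [not_lt] at hc
    have h3 : (1 - t + t ^ 2 / 2) * (1 + t + t ^ 2 / 2) ≤ Real.exp (-t) * Real.exp t :=
      mul_le_mul hc h (by positivity) (Real.exp_pos _).le
    have h4 : 0 < t ^ 4 := by positivity
    linarith
  have e : 1 - 1 / t + (1 - Real.exp (-t)) / t ^ 2 - 1 / 2 =
      (1 - t + t ^ 2 / 2 - Real.exp (-t)) / t ^ 2 := by
    field_simp
    ring
  have : 0 < (1 - t + t ^ 2 / 2 - Real.exp (-t)) / t ^ 2 := div_pos (by linarith) (by positivity)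
  linarith

theorem bopMean_lt_one {t : ℝ} (ht : 0 < t) : bopMean t < 1 := by
  rw [bopMean, integral_mul_bopDensity ht]
  have h := Real.add_one_lt_exp (x := -t) (by linarith)
  have e : 1 - (1 - 1 / t + (1 - Real.exp (-t)) / t ^ 2) = (Real.exp (-t) - (-t + 1)) / t ^ 2 := by
    field_simp
    ring
  have : 0 < (Real.exp (-t) - (-t + 1)) / t ^ 2 := div_pos (by linarith) (by positivity)
  linarith

theorem le_bopMean {t : ℝ} (ht : 0 < t) : 1 - 1 / t ≤ bopMean t := by
  rw [bopMean, integral_mul_bopDensity ht]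
  have h : Real.exp (-t) ≤ 1 := Real.exp_le_one_iff.2 (by linarith)
  have : 0 ≤ (1 - Real.exp (-t)) / t ^ 2 := div_nonneg (by linarith) (by positivity)
  linarith

theorem bopMean_le {t : ℝ} (ht : 0 < t) (h1 : t ≤ 1) : bopMean t ≤ 1 / 2 + t := by
  rw [bopMean, integral_mul_bopDensity ht]
  have h := le_exp_neg ht.le h1
  have e : 1 / 2 + t - (1 - 1 / t + (1 - Real.exp (-t)) / t ^ 2) =
      (Real.exp (-t) - (1 - t + t ^ 2 / 2 - t ^ 3)) / t ^ 2 := by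
    field_simp
    ring
  have h3 : 0 ≤ t ^ 3 := by positivity
  have h4 : 0 ≤ t ^ 4 := by positivity
  have h5 : t ^ 5 ≤ t ^ 3 := pow_le_pow_of_le_one ht.le h1 (by norm_num)
  have : 0 ≤ (Real.exp (-t) - (1 - t + t ^ 2 / 2 - t ^ 3)) / t ^ 2 :=
    div_nonneg (by linarith) (by positivity)
  linarith

theorem tiltMean_eq {l : ℝ} (hl : 0 < l) :
    tiltMean l = 1 + (1 / (Real.exp l - 1) - 1 / l) := by
  have := (exp_sub_one_pos hl).ne'
  rw [tiltMean, integral_mul_tiltDensity hl]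
  field_simp
  ring

theorem le_tiltMean {l : ℝ} (hl : 0 < l) : 1 - 1 / l ≤ tiltMean l := by
  rw [tiltMean_eq hl]
  have : 0 ≤ 1 / (Real.exp l - 1) := (one_div_pos.2 (exp_sub_one_pos hl)).le
  linarith

theorem tiltMean_le {l : ℝ} (hl : 0 < l) : tiltMean l ≤ 1 / 2 + l := by
  rw [tiltMean_eq hl]
  have h := Real.quadratic_le_exp_of_nonneg hl.le
  have h2 : 1 / (Real.exp l - 1) ≤ 1 / (l + l ^ 2 / 2) :=
    one_div_le_one_div_of_le (by positivity) (by linarith)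
  have e : 1 / (l + l ^ 2 / 2) - 1 / l = -(1 / (2 + l)) := by
    field_simp
    ring
  have h3 : 1 / 2 - l ≤ 1 / (2 + l) := by
    rw [le_div_iff₀ (by positivity)]
    nlinarith
  linarith

theorem strictMonoOn_tiltMean : StrictMonoOn tiltMean (Set.Ioi 0) := by
  have hd : ∀ l : ℝ, 0 < l → HasDerivAt (fun l => 1 + (1 / (Real.exp l - 1) - 1 / l))
      (-Real.exp l / (Real.exp l - 1) ^ 2 + 1 / l ^ 2) l := fun l hl => by
    have h1 := ((Real.hasDerivAt_exp l).sub_const 1).inv (exp_sub_one_pos hl).ne'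
    have h2 := hasDerivAt_inv hl.ne'
    simp only [one_div]
    refine HasDerivAt.congr_deriv ((h1.sub h2).const_add 1) ?_
    ring
  have hm : StrictMonoOn (fun l => 1 + (1 / (Real.exp l - 1) - 1 / l)) (Set.Ioi (0 : ℝ)) := by
    refine strictMonoOn_of_hasDerivWithinAt_pos (convex_Ioi 0)
      (fun x hx => (hd x hx).continuousAt.continuousWithinAt)
      (fun x hx => (hd x (interior_subset hx)).hasDerivWithinAt) fun x hx => ?_
    have hx0 : 0 < x := interior_subset hx
    have hE := exp_sub_one_pos hx0
    have hsq : Real.exp x = Real.exp (x / 2) ^ 2 := by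
      rw [← Real.exp_nat_mul]
      congr 1
      push_cast
      ring
    -- Positivity of the derivative means `x ^ 2 * exp x < (exp x - 1) ^ 2`; after a square root and
    -- division by `2 * exp (x / 2)` this is `x / 2 < sinh (x / 2)`.
    have hs : x * Real.exp (x / 2) < Real.exp x - 1 := by
      have h := Real.self_lt_sinh_iff.2 (half_pos hx0)
      rw [Real.sinh_eq, Real.exp_neg] at h
      have hp := Real.exp_pos (x / 2)
      have := mul_lt_mul_of_pos_right h hp
      have e : (Real.exp (x / 2) - (Real.exp (x / 2))⁻¹) / 2 * Real.exp (x / 2) =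
          (Real.exp (x / 2) ^ 2 - 1) / 2 := by
        field_simp
      rw [e, ← hsq] at this
      linarith
    have hs2 : (x * Real.exp (x / 2)) ^ 2 < (Real.exp x - 1) ^ 2 :=
      pow_lt_pow_left₀ hs (by positivity) two_ne_zero
    rw [mul_pow, ← hsq] at hs2
    have e : -Real.exp x / (Real.exp x - 1) ^ 2 + 1 / x ^ 2 =
        ((Real.exp x - 1) ^ 2 - x ^ 2 * Real.exp x) / ((Real.exp x - 1) ^ 2 * x ^ 2) := by
      field_simp
      ring
    rw [e]
    exact div_pos (by linarith) (by positivity)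
  exact hm.congr fun l hl => (tiltMean_eq hl).symm

/-- Intermediate values of a continuous function on `(0, ∞)` with limits `1 / 2` and `1`. -/
theorem exists_eq_of_bounds {f : ℝ → ℝ} (hf : ContinuousOn f (Set.Ioi 0))
    (hlow : ∀ t, 0 < t → t ≤ 1 → f t ≤ 1 / 2 + t) (hhigh : ∀ t, 0 < t → 1 - 1 / t ≤ f t) {m : ℝ}
    (hm : m ∈ Set.Ioo (1 / 2 : ℝ) 1) : ∃ t, 0 < t ∧ f t = m := by
  have h1 : 0 < m - 1 / 2 := by linarith [hm.1]
  have h2 : 0 < 1 - m := by linarith [hm.2]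
  have hb : 1 ≤ 1 / (1 - m) := by
    rw [le_div_iff₀ h2]
    linarith [hm.1]
  have hab : m - 1 / 2 ≤ 1 / (1 - m) := by linarith [hm.2]
  have hsub : Set.Icc (m - 1 / 2) (1 / (1 - m)) ⊆ Set.Ioi 0 := fun x hx => h1.trans_le hx.1
  -- The endpoints are those at which the two bounds equal `m`.
  have ha := hlow (m - 1 / 2) h1 (by linarith [hm.2])
  have hc := hhigh (1 / (1 - m)) (by positivity)
  rw [one_div_one_div] at hc
  obtain ⟨t, ht, e⟩ := intermediate_value_Icc hab (hf.mono hsub)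
    (show m ∈ Set.Icc (f (m - 1 / 2)) (f (1 / (1 - m))) from ⟨by linarith, by linarith⟩)
  exact ⟨t, hsub ht, e⟩

theorem exists_bopMean_eq {m : ℝ} (hm : m ∈ Set.Ioo (1 / 2 : ℝ) 1) :
    ∃ t, 0 < t ∧ bopMean t = m := by
  refine exists_eq_of_bounds ?_ (fun _ => bopMean_le) (fun _ => le_bopMean) hm
  have : ContinuousOn (fun t : ℝ => 1 - 1 / t + (1 - Real.exp (-t)) / t ^ 2) (Set.Ioi 0) := by
    refine ContinuousOn.add (continuousOn_const.sub (continuousOn_const.div continuousOn_id ?_))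
      (ContinuousOn.div (by fun_prop) (by fun_prop) ?_)
    · exact fun x hx => ne_of_gt hx
    · exact fun x hx => pow_ne_zero 2 (ne_of_gt hx)
  exact this.congr fun t ht => integral_mul_bopDensity ht

theorem exists_tiltMean_eq {m : ℝ} (hm : m ∈ Set.Ioo (1 / 2 : ℝ) 1) :
    ∃ l, 0 < l ∧ tiltMean l = m := by
  refine exists_eq_of_bounds ?_ (fun t h0 _ => tiltMean_le h0) (fun _ => le_tiltMean) hm
  have : ContinuousOn (fun l : ℝ => 1 + (1 / (Real.exp l - 1) - 1 / l)) (Set.Ioi 0) := by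
    refine continuousOn_const.add (ContinuousOn.sub (continuousOn_const.div (by fun_prop) ?_)
      (continuousOn_const.div continuousOn_id ?_))
    · exact fun x hx => (exp_sub_one_pos hx).ne'
    · exact fun x hx => ne_of_gt hx
  exact this.congr fun t ht => tiltMean_eq ht

end BestOfPoisson

/-! ### Assembly: the Pythagorean identity and minimality of the matching tilt -/

theorem mainTheorem6 {X : Type*} [MeasurableSpace X]
    (ref : Measure X) [IsProbabilityMeasure ref] (r : X → ℝ) (hr : Measurable r)
    (hunif : pdf.IsUniform r (Set.Icc (0 : ℝ) 1) ref volume) :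
    -- the laws of BoP and of the tilt, through their densities with respect to `ref`
    (∀ μ : ℝ≥0, 0 < μ → BestOfPoisson.bopLaw ref r μ =
      ref.withDensity fun x => ENNReal.ofReal (BestOfPoisson.bopDensity μ (r x))) ∧
    (∀ l : ℝ, 0 < l → BestOfPoisson.tiltLaw ref r l =
      ref.withDensity fun x => ENNReal.ofReal (BestOfPoisson.tiltDensity l (r x))) ∧
    -- every reward level is attained by both families
    (∀ m ∈ Set.Ioo (1 / 2 : ℝ) 1, ∃ μ : ℝ≥0, 0 < μ ∧ ∃ l : ℝ, 0 < l ∧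
      BestOfPoisson.meanReward (BestOfPoisson.bopLaw ref r μ) r = m ∧
      BestOfPoisson.meanReward (BestOfPoisson.tiltLaw ref r l) r = m) ∧
    -- the matching tilt exists and is unique
    (∀ μ : ℝ≥0, 0 < μ → ∃! l : ℝ, 0 < l ∧
      BestOfPoisson.meanReward (BestOfPoisson.bopLaw ref r μ) r =
        BestOfPoisson.meanReward (BestOfPoisson.tiltLaw ref r l) r) ∧
    -- the KL gap at equal expected reward
    (∀ μ : ℝ≥0, 0 < μ → ∀ l : ℝ, 0 < l →
      BestOfPoisson.meanReward (BestOfPoisson.bopLaw ref r μ) r =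
        BestOfPoisson.meanReward (BestOfPoisson.tiltLaw ref r l) r →
      klDiv (BestOfPoisson.bopLaw ref r μ) ref ≠ ∞ ∧
      klDiv (BestOfPoisson.tiltLaw ref r l) ref ≠ ∞ ∧
      klDiv (BestOfPoisson.bopLaw ref r μ) (BestOfPoisson.tiltLaw ref r l) ≠ ∞ ∧
      (klDiv (BestOfPoisson.bopLaw ref r μ) ref).toReal -
          (klDiv (BestOfPoisson.tiltLaw ref r l) ref).toReal =
        (klDiv (BestOfPoisson.bopLaw ref r μ) (BestOfPoisson.tiltLaw ref r l)).toReal ∧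
      0 ≤ (klDiv (BestOfPoisson.bopLaw ref r μ) ref).toReal -
          (klDiv (BestOfPoisson.tiltLaw ref r l) ref).toReal ∧
      (klDiv (BestOfPoisson.bopLaw ref r μ) ref).toReal -
          (klDiv (BestOfPoisson.tiltLaw ref r l) ref).toReal ≤ 8 * (10 : ℝ) ^ (-4 : ℤ)) := by
  have hbop : ∀ μ : ℝ≥0, BestOfPoisson.bopLaw ref r μ =
      ref.withDensity fun x => ENNReal.ofReal (BestOfPoisson.bopDensity μ (r x)) :=
    BestOfPoisson.bopLaw_eq_withDensity hr hunif
  have htilt : ∀ l : ℝ, 0 < l → BestOfPoisson.tiltLaw ref r l =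
      ref.withDensity fun x => ENNReal.ofReal (BestOfPoisson.tiltDensity l (r x)) :=
    fun l hl => BestOfPoisson.tiltLaw_eq_withDensity hr hunif hl
  have hbm : ∀ μ : ℝ≥0, 0 < μ → BestOfPoisson.meanReward (BestOfPoisson.bopLaw ref r μ) r =
      BestOfPoisson.bopMean μ := fun μ hμ => by
    rw [BestOfPoisson.meanReward, hbop]
    exact BestOfPoisson.integral_withDensity_reward hr hunif (BestOfPoisson.isUnitDensity_bop hμ)
      measurable_id
  have htm : ∀ l : ℝ, 0 < l → BestOfPoisson.meanReward (BestOfPoisson.tiltLaw ref r l) r =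
      BestOfPoisson.tiltMean l := fun l hl => by
    rw [BestOfPoisson.meanReward, htilt l hl]
    exact BestOfPoisson.integral_withDensity_reward hr hunif (BestOfPoisson.isUnitDensity_tilt hl)
      measurable_id
  refine ⟨fun μ _ => hbop μ, htilt, fun m hm => ?_, fun μ hμ => ?_, fun μ hμ l hl hmean => ?_⟩
  · obtain ⟨t, ht, et⟩ := BestOfPoisson.exists_bopMean_eq hm
    obtain ⟨l, hl, el⟩ := BestOfPoisson.exists_tiltMean_eq hm
    have ht' : (0 : ℝ≥0) < ⟨t, ht.le⟩ := ht
    exact ⟨⟨t, ht.le⟩, ht', l, hl, (hbm _ ht').trans et, (htm l hl).trans el⟩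
  · obtain ⟨l, hl, el⟩ := BestOfPoisson.exists_tiltMean_eq
      ⟨BestOfPoisson.half_lt_bopMean (t := μ) hμ, BestOfPoisson.bopMean_lt_one (t := μ) hμ⟩
    refine ⟨l, ⟨hl, by rw [hbm μ hμ, htm l hl, el]⟩, fun l' hl' => ?_⟩
    have h := hl'.2
    rw [hbm μ hμ, htm l' hl'.1, ← el] at h
    exact BestOfPoisson.strictMonoOn_tiltMean.injOn hl'.1 hl h.symm
  · rw [hbm μ hμ, htm l hl] at hmean
    have hq := BestOfPoisson.isUnitDensity_bop (t := μ) hμ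
    have hg := BestOfPoisson.isUnitDensity_tilt hl
    have href : ref.withDensity (fun x => ENNReal.ofReal ((fun _ : ℝ => (1 : ℝ)) (r x))) = ref := by
      simp
    obtain ⟨f1, k1⟩ := BestOfPoisson.klDiv_withDensity_reward hr hunif hq
      BestOfPoisson.isUnitDensity_one
    obtain ⟨f2, k2⟩ := BestOfPoisson.klDiv_withDensity_reward hr hunif hg
      BestOfPoisson.isUnitDensity_one
    obtain ⟨f3, k3⟩ := BestOfPoisson.klDiv_withDensity_reward hr hunif hq hg
    rw [href, ← hbop] at f1 k1
    rw [href, ← htilt l hl] at f2 k2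
    rw [← hbop, ← htilt l hl] at f3 k3
    have hpyth : BestOfPoisson.klUnit (BestOfPoisson.bopDensity μ) (fun _ => 1) -
        BestOfPoisson.klUnit (BestOfPoisson.tiltDensity l) (fun _ => 1) =
        BestOfPoisson.klUnit (BestOfPoisson.bopDensity μ) (BestOfPoisson.tiltDensity l) := by
      rw [BestOfPoisson.klUnit_eq_sub hq BestOfPoisson.isUnitDensity_one,
        BestOfPoisson.klUnit_eq_sub hg BestOfPoisson.isUnitDensity_one,
        BestOfPoisson.klUnit_eq_sub hq hg, BestOfPoisson.integral_mul_log_tiltDensity hg hl,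
        BestOfPoisson.integral_mul_log_tiltDensity hq hl]
      simp only [BestOfPoisson.bopMean, BestOfPoisson.tiltMean] at hmean
      simp [hmean]
    -- At equal means the difference of the two sides is `KL(g_l‖g_l')`, whose nonnegativity is read
    -- off from `klDiv` being valued in `ℝ≥0∞`.
    have hmin : ∀ l', 0 < l' →
        BestOfPoisson.klUnit (BestOfPoisson.bopDensity μ) (BestOfPoisson.tiltDensity l) ≤
        BestOfPoisson.klUnit (BestOfPoisson.bopDensity μ) (BestOfPoisson.tiltDensity l') := by
      intro l' hl'
      have hg' := BestOfPoisson.isUnitDensity_tilt hl'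
      have hnn : 0 ≤ BestOfPoisson.klUnit (BestOfPoisson.tiltDensity l)
          (BestOfPoisson.tiltDensity l') := by
        rw [← (BestOfPoisson.klDiv_withDensity_reward hr hunif hg hg').2]
        exact ENNReal.toReal_nonneg
      rw [BestOfPoisson.klUnit_eq_sub hg hg', BestOfPoisson.integral_mul_log_tiltDensity hg hl,
        BestOfPoisson.integral_mul_log_tiltDensity hg hl'] at hnn
      rw [BestOfPoisson.klUnit_eq_sub hq hg, BestOfPoisson.klUnit_eq_sub hq hg',
        BestOfPoisson.integral_mul_log_tiltDensity hq hl,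
        BestOfPoisson.integral_mul_log_tiltDensity hq hl']
      simp only [BestOfPoisson.bopMean, BestOfPoisson.tiltMean] at hmean
      rw [hmean]
      linarith
    obtain ⟨l', hl', hle⟩ := BestOfPoisson.exists_klUnit_le (t := μ) hμ
    refine ⟨f1, f2, f3, ?_, ?_, ?_⟩
    · rw [k1, k2, k3, hpyth]
    · rw [k1, k2, hpyth, ← k3]
      exact ENNReal.toReal_nonneg
    · rw [k1, k2, hpyth]
      exact (hmin l' hl').trans hle
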